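/- Fix $\hbar>0$. For a finite-dimensional Euclidean space $\mathbb R^d$ put $\hat\varphi(\xi)=(2\pi\hbar)^{-d/2}\int e^{-\frac{i}{\hbar}\xi\cdot x}\varphi(x)\,dx$ (extended to tempered distributions), $\langle g,\gamma\rangle=\int g\,\overline{\gamma}$, $\pi(x,\xi)g(y)=(2\pi\hbar)^{-d/2}e^{\frac{i}{\hbar}\xi\cdot y}g(y-x)$ and, for $g\in\mathcal S(\mathbb R^d)$, $u\in\mathcal S'(\mathbb R^d)$, $V_gu(x,\xi)=\langle u,\pi(x,\xi)g\rangle=u(\overline{\pi(x,\xi)g})$. The Sjöstrand class $M^{\infty,1}(\mathbb R^d)$ consists of the $u\in\mathcal S'(\mathbb R^d)$ with $\int\sup_x|V_gu(x,\xi)|\,d\xi<\infty$ for some $g\in\mathcal S(\mathbb R^d)\setminus\{0\}$; its elements are identified with their continuous representatives. Let $F_+(x)=(2\pi i\hbar)^{-d/2}e^{\frac{i}{2\hbar}|x|^2}$ (principal branch). A function $f$ on $\mathbb R^n$ is Fresnel integrable, with Fresnel integral $L_n(f)$, if $\int F_+(x)f(x)\varphi(\varepsilon x)\,dx\to L_n(f)$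 as $\varepsilon\downarrow0$ for every $\varphi\in\mathcal S(\mathbb R^n)$ with $\varphi(0)=1$ (these integrals being absolutely convergent). For $f:\mathbb R^{\mathbb N}\to\mathbb C$ put $f^{(n)}(x_1,\dots,x_n)=f(x_1,\dots,x_n,0,0,\dots)$; let $D(L')$ be the set of all $f$ such that $f^{(n)}\in M^{\infty,1}(\mathbb R^n)$ for all $n$ and $\lim_nL_n(f^{(n)})$ exists in $\mathbb C$, and let $L'(f)$ be this limit. For a real Hilbert space $\mathcal H$, $\mathcal{FM}(\mathcal H)$ is the class of functions $x\mapsto\int_{\mathcal H}e^{i\langle x,y\rangle}\,d\mu(y)$ with $\mu$ a complex Borel measure on $\mathcal H$. Let $k\in\ell^2(\mathbb N)$ be real and $\pi_nk=(k_1,\dots,k_n)$. In what follows $F_+$ is taken on $\mathbb R$, and $(F_+\circ\lambda)(y)=F_+(\lambda y)$ for $\lambda\ge0$. For $g\in\mathcal S(\mathbb R)$ set $$T_n(H)=\int_{\mathbb R^2}H(x,\xi)\,\overline{V_g(F_+\circ\|\pi_nk\|)(x,\xi)}\,dx\,d\xi,\qquad T(H)=\int_{\mathbb R^2}H(x,\xi)\,\overline{V_g(F_+\circ\|k\|)(x,\xi)}\,dx\,d\xi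 .$$ **(a)** For every $g\in\mathcal S(\mathbb R)$, $T_n$ and $T$ are well-defined linear functionals on $L^1_x(L^\infty_\xi)(\mathbb R^2)$ (the integrals converge absolutely); the $T_n$ are uniformly bounded with respect to $n$; there is a dense subspace $X\subset L^1_x(L^\infty_\xi)(\mathbb R^2)$ with $T_n(H)\to T(H)$ for all $H\in X$; and $T_n(H)\to T(H)$ for all $H\in L^1_x(L^\infty_\xi)(\mathbb R^2)$. **(b)** Let $h\in M^{\infty,1}(\mathbb R)$, and let $f(x)=h(k\cdot x)$ for $x\in\ell^2(\mathbb N)$ and $f(x)=0$ for $x\in\mathbb R^{\mathbb N}\setminus\ell^2(\mathbb N)$. Then $f\in D(L')$. Moreover, for all $g,\gamma\in\mathcal S(\mathbb R)$ with $\langle g,\gamma\rangle\ne0$ one has $V_\gamma\hat h\in L^1_x(L^\infty_\xi)(\mathbb R^2)$; every $f^{(n)}$ is Fresnel integrable with $$L_n(f^{(n)})=e^{-i\pi/4}\,\frac{1}{\langle g,\gamma\rangle}\,T_n(V_\gamma\hat h);$$ and $$L'(f)=\lim_{n\to\infty}L_n(f^{(n)})=e^{-i\pi/4}\,\frac1{\langle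 g,\gamma\rangle}\int_{\mathbb R^2}V_\gamma\hat h(x,\xi)\,\overline{V_g(F_+\circ\|k\|_{\ell^2})(x,\xi)}\,dx\,d\xi=e^{-i\pi/4}\,\langle\hat h,F_+\circ\|k\|_{\ell^2}\rangle_* .$$ **(c)** If, in (b), $k\neq0$ and $h\notin\mathcal{FM}(\mathbb R)$, then the restriction of $f$ to $\ell^2(\mathbb N)$ does not belong to $\mathcal{FM}(\ell^2(\mathbb N))$. Functions $h\in M^{\infty,1}(\mathbb R)\setminus\mathcal{FM}(\mathbb R)$ exist. -/

import Mathlib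

open MeasureTheory Filter Topology Module
open scoped SchwartzMap FourierTransform ENNReal ComplexConjugate

noncomputable section

namespace FresnelSjostrand

section Euclidean

variable {E : Type*} [NormedAddCommGroup E] [InnerProductSpace ℝ E] [FiniteDimensional ℝ E]
  [MeasurableSpace E] [BorelSpace E]

/-! ### Fourier transform and Gabor transform with parameter `ħ`

Throughout `d = finrank ℝ E`. -/

/-- The constant `(2πħ)^{-d/2}`. -/
def planckConst (ħ : ℝ) (E : Type*) [NormedAddCommGroup E] [InnerProductSpace ℝ E] : ℂ :=
  (((2 * Real.pi * ħ) ^ (-(finrank ℝ E : ℝ) / 2) : ℝ) : ℂ)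

/-- The Fourier transform `φ̂(ξ) = (2πħ)^{-d/2} ∫ e^{-(i/ħ) ξ·x} φ(x) dx` on Schwartz functions:
Mathlib's Fourier transform `𝓕 φ (η) = ∫ e^{-2πi η·x} φ(x) dx` evaluated at `η = ξ / (2πħ)` and
normalised; the integral formula is `fourierSchwartz_apply`. -/
def fourierSchwartz (ħ : ℝ) (hħ : 0 < ħ) : 𝓢(E, ℂ) →L[ℂ] 𝓢(E, ℂ) :=
  planckConst ħ E •
    (SchwartzMap.compCLMOfContinuousLinearEquiv ℂ
      (ContinuousLinearEquiv.smulLeft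
        (Units.mk0 ((2 * Real.pi * ħ)⁻¹) (by positivity)) : E ≃L[ℝ] E) ∘L
      FourierTransform.fourierCLM ℂ 𝓢(E, ℂ))

theorem fourierSchwartz_apply (ħ : ℝ) (hħ : 0 < ħ) (φ : 𝓢(E, ℂ)) (ξ : E) :
    fourierSchwartz ħ hħ φ ξ =
      planckConst ħ E * ∫ x, Complex.exp (-(Complex.I / ħ) * (inner ℝ ξ x : ℝ)) * φ x := by
  have h : fourierSchwartz ħ hħ φ ξ =
      planckConst ħ E * 𝓕 (φ : E → ℂ) ((2 * Real.pi * ħ)⁻¹ • ξ) := by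
    rfl
  rw [h, Real.fourier_eq']
  congr 1
  apply integral_congr_ae
  filter_upwards with x
  rw [smul_eq_mul, inner_smul_right, real_inner_comm]
  congr 2
  push_cast
  have h1 : (ħ : ℂ) ≠ 0 := by exact_mod_cast hħ.ne'
  have h2 : (Real.pi : ℂ) ≠ 0 := by exact_mod_cast Real.pi_ne_zero
  field_simp

/-- The Fourier transform of a tempered distribution, `⟨û, φ⟩ = ⟨u, φ̂⟩` (bilinear pairings). -/
def fourierDist (ħ : ℝ) (hħ : 0 < ħ) (u : 𝓢'(E, ℂ)) : 𝓢'(E, ℂ) :=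
  PointwiseConvergenceCLM.precomp ℂ (fourierSchwartz ħ hħ) u

/-- Pointwise complex conjugation of a Schwartz function. -/
def conjSchwartz (φ : 𝓢(E, ℂ)) : 𝓢(E, ℂ) :=
  SchwartzMap.postcompCLM (𝕜 := ℝ) (Complex.conjCLE : ℂ →L[ℝ] ℂ) φ

/-- The modulation factor `y ↦ (2πħ)^{-d/2} e^{(i/ħ) ξ·y}`. -/
def modulation (ħ : ℝ) (ξ : E) (y : E) : ℂ :=
  planckConst ħ E * Complex.exp (Complex.I / ħ * (inner ℝ ξ y : ℝ))

theorem modulation_hasTemperateGrowth (ħ : ℝ) (ξ : E) :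
    (modulation ħ ξ : E → ℂ).HasTemperateGrowth := by
  have h1 : ∀ n : ℕ, iteratedDeriv n (fun t : ℝ => Complex.exp (Complex.I / ħ * t)) =
      fun t : ℝ => (Complex.I / ħ) ^ n * Complex.exp (Complex.I / ħ * t) := by
    intro n
    induction n with
    | zero => simp
    | succ n ih =>
      rw [iteratedDeriv_succ, ih]
      ext t
      have h : HasDerivAt (fun t : ℝ => (Complex.I / ħ) ^ n * Complex.exp (Complex.I / ħ * t))
          ((Complex.I / ħ) ^ n * (Complex.exp (Complex.I / ħ * t) * (Complex.I / ħ * 1))) t :=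
        (((Complex.ofRealCLM.hasDerivAt (x := t)).const_mul (Complex.I / ħ : ℂ)).cexp).const_mul _
      rw [h.deriv]
      ring
  have h2 : (fun t : ℝ => Complex.exp (Complex.I / ħ * t)).HasTemperateGrowth := by
    refine ⟨(contDiff_const.mul Complex.ofRealCLM.contDiff).cexp, fun n => ⟨0, ‖(Complex.I / ħ : ℂ) ^ n‖, fun t => ?_⟩⟩
    rw [norm_iteratedFDeriv_eq_norm_iteratedDeriv, h1 n, norm_mul]
    have : Complex.I / ħ * t = ((t / ħ : ℝ) : ℂ) * Complex.I := by push_cast; ring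
    rw [this, Complex.norm_exp_ofReal_mul_I]
    simp
  have h3 : (fun y : E => (inner ℝ ξ y : ℝ)).HasTemperateGrowth :=
    Function.hasTemperateGrowth_inner_right ξ
  exact (Function.HasTemperateGrowth.const (planckConst ħ E)).mul (h2.comp h3)

/-- The phase space shift `π(x,ξ)g (y) = (2πħ)^{-d/2} e^{(i/ħ) ξ·y} g(y - x)`; the pointwise
formula is `phaseShift_apply`. -/
def phaseShift (ħ : ℝ) (x ξ : E) (g : 𝓢(E, ℂ)) : 𝓢(E, ℂ) :=
  SchwartzMap.smulLeftCLM ℂ (modulation ħ ξ) (SchwartzMap.compSubConstCLM ℂ x g)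

theorem phaseShift_apply (ħ : ℝ) (x ξ : E) (g : 𝓢(E, ℂ)) (y : E) :
    phaseShift ħ x ξ g y =
      planckConst ħ E * Complex.exp (Complex.I / ħ * (inner ℝ ξ y : ℝ)) * g (y - x) := by
  simp [phaseShift, SchwartzMap.smulLeftCLM_apply_apply (modulation_hasTemperateGrowth ħ ξ),
    modulation]

/-- The Gabor transform of a tempered distribution, `V_g u(x,ξ) = ⟨u, π(x,ξ)g⟩`, where
`⟨u, φ⟩ = u(conj φ)`. -/
def stft (ħ : ℝ) (g : 𝓢(E, ℂ)) (u : 𝓢'(E, ℂ)) (x ξ : E) : ℂ :=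
  u (conjSchwartz (phaseShift ħ x ξ g))

/-- The Gabor transform of a (bounded measurable) function, `V_g f(x,ξ) = ∫ f conj(π(x,ξ)g)`. -/
def stftFun (ħ : ℝ) (g : 𝓢(E, ℂ)) (f : E → ℂ) (x ξ : E) : ℂ :=
  ∫ y, f y * conj (phaseShift ħ x ξ g y)

/-! ### The Sjöstrand class -/

/-- The norm `∫ sup_x |V_g u(x,ξ)| dξ` with window `g`, as an extended nonnegative number. -/
def sjostrandNorm (ħ : ℝ) (g : 𝓢(E, ℂ)) (u : 𝓢'(E, ℂ)) : ℝ≥0∞ :=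
  ∫⁻ ξ, ⨆ x, ‖stft ħ g u x ξ‖ₑ

/-- The tempered distribution `u` is given by integration against the function `f`. -/
def Represents (f : E → ℂ) (u : 𝓢'(E, ℂ)) : Prop :=
  ∀ φ : 𝓢(E, ℂ), Integrable (fun x => φ x * f x) ∧ u φ = ∫ x, φ x * f x

open Classical in
/-- The tempered distribution given by integration against `f` (the zero distribution if there
is none). -/
def toDist (f : E → ℂ) : 𝓢'(E, ℂ) :=
  if h : ∃ u : 𝓢'(E, ℂ), Represents f u then h.choose else 0

/-- `f ∈ M^{∞,1}(E)`, for functions: every distribution in the Sjöstrand class is a (bounded)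
continuous function, and `f` is this continuous function, rather than another representative of
its almost-everywhere class. -/
def MemSjostrand (ħ : ℝ) (f : E → ℂ) : Prop :=
  Continuous f ∧ ∃ u : 𝓢'(E, ℂ), Represents f u ∧
    ∃ g : 𝓢(E, ℂ), g ≠ 0 ∧ sjostrandNorm ħ g u < ∞

/-! ### Fresnel integrals in finite dimension -/

/-- The constant `(2πiħ)^{-d/2}` (principal branch). -/
def fresnelConst (ħ : ℝ) (E : Type*) [NormedAddCommGroup E] [InnerProductSpace ℝ E] : ℂ :=
  (2 * Real.pi * Complex.I * ħ) ^ (-(finrank ℝ E : ℂ) / 2)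

/-- `F₊(x) = (2πiħ)^{-d/2} e^{(i/2ħ)|x|²}`. -/
def fresnelFun (ħ : ℝ) (x : E) : ℂ :=
  fresnelConst ħ E * Complex.exp (Complex.I / (2 * ħ) * (‖x‖ ^ 2 : ℝ))

/-- `f` is Fresnel integrable with Fresnel integral `I`: for every Schwartz `φ` with `φ(0) = 1`,
`(2πiħ)^{-d/2} ∫ e^{(i/2ħ)|x|²} f(x) φ(εx) dx → I` as `ε ↓ 0`. -/
def HasFresnelIntegral (ħ : ℝ) (f : E → ℂ) (I : ℂ) : Prop :=
  ∀ φ : 𝓢(E, ℂ), φ 0 = 1 →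
    (∀ ε : ℝ, 0 < ε → Integrable (fun x => fresnelFun ħ x * f x * φ (ε • x))) ∧
    Tendsto (fun ε : ℝ => ∫ x, fresnelFun ħ x * f x * φ (ε • x)) (𝓝[>] 0) (𝓝 I)

open Classical in
/-- The Fresnel integral of a Fresnel integrable function (and `0` for other functions). -/
def fresnelIntegral (ħ : ℝ) (f : E → ℂ) : ℂ :=
  if h : ∃ I, HasFresnelIntegral ħ f I then h.choose else 0

/-! ### The duality pairing -/

/-- `⟨g, γ⟩ = ∫ g conj γ` on Schwartz functions. -/
def innerSchwartz (g γ : 𝓢(E, ℂ)) : ℂ := ∫ y, g y * conj (γ y)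

/-- The pairing `⟨u, f⟩_* = ⟨g, γ⟩⁻¹ ∫∫ V_γ u(x,ξ) conj(V_g f(x,ξ)) dx dξ`, computed with the
windows `g`, `γ`. -/
def starPairing (ħ : ℝ) (g γ : 𝓢(E, ℂ)) (u : 𝓢'(E, ℂ)) (f : E → ℂ) : ℂ :=
  (innerSchwartz g γ)⁻¹ * ∫ z : E × E, stft ħ γ u z.1 z.2 * conj (stftFun ħ g f z.1 z.2)

end Euclidean

/-! ### Functions on sequence space -/

/-- The real Hilbert space `ℓ²(ℕ)`. -/
abbrev L2seq : Type := lp (fun _ : ℕ => ℝ) 2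

/-- `f^{(n)}(x₁,…,xₙ) = f(x₁,…,xₙ,0,0,…)`. -/
def restrictFin (f : (ℕ → ℝ) → ℂ) (n : ℕ) (x : EuclideanSpace ℝ (Fin n)) : ℂ :=
  f (fun j => if hj : j < n then x ⟨j, hj⟩ else 0)

/-- The domain `D(L')`: all `f^{(n)}` belong to `M^{∞,1}(ℝⁿ)` and the Fresnel integrals
`L_n(f^{(n)})` converge. -/
def domainL' (ħ : ℝ) : Set ((ℕ → ℝ) → ℂ) :=
  {f | (∀ n, MemSjostrand ħ (restrictFin f n)) ∧
    ∃ ℓ : ℂ, Tendsto (fun n => fresnelIntegral ħ (restrictFin f n)) atTop (𝓝 ℓ)}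

/-- The functional `L'(f) = lim L_n(f^{(n)})`. -/
def functionalL' (ħ : ℝ) (f : (ℕ → ℝ) → ℂ) : ℂ :=
  limUnder atTop (fun n => fresnelIntegral ħ (restrictFin f n))

open Classical in
/-- The function equal to `h(k·x)` for `x ∈ ℓ²` and to `0` for the other sequences. -/
def ridge (h : ℝ → ℂ) (k : L2seq) (x : ℕ → ℝ) : ℂ :=
  if hx : Memℓp x 2 then h (inner ℝ k (⟨x, hx⟩ : L2seq)) else 0

/-- The projection `π_n k = (k₁,…,kₙ)`. -/
def proj (n : ℕ) (k : L2seq) : EuclideanSpace ℝ (Fin n) :=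
  WithLp.toLp 2 (fun j : Fin n => k j)

/-- The class `𝓕𝓜(H)` of the functions `x ↦ ∫ e^{i⟨x,y⟩} dμ(y)`, where `μ` is a complex Borel
measure on the Hilbert space `H`. -/
def fourierMeasures (H : Type*) [NormedAddCommGroup H] [InnerProductSpace ℝ H] : Set (H → ℂ) :=
  letI : MeasurableSpace H := borel H
  {f | ∃ μ : ComplexMeasure H, ∀ x,
    f x = VectorMeasure.integral μ (fun y => Complex.exp (Complex.I * (inner ℝ x y : ℝ)))
      (ContinuousLinearMap.mul ℝ ℂ)}

/-! ### The space `L¹_x(L^∞_ξ)` -/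

/-- The norm `∫ ess sup_ξ |H(x,ξ)| dx`. -/
def mixedNorm (H : ℝ × ℝ → ℂ) : ℝ≥0∞ :=
  ∫⁻ x, eLpNorm (fun ξ => H (x, ξ)) ∞

theorem mixedNorm_add_le {H K : ℝ × ℝ → ℂ} (hH : AEStronglyMeasurable H)
    (hK : AEStronglyMeasurable K) : mixedNorm (H + K) ≤ mixedNorm H + mixedNorm K := by
  have slice : ∀ {G : ℝ × ℝ → ℂ}, AEStronglyMeasurable G →
      ∀ᵐ x : ℝ, AEStronglyMeasurable (fun ξ : ℝ => G (x, ξ)) := by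
    intro G hG
    exact hG.prodMk_left
  have meas : AEMeasurable (fun x : ℝ => eLpNorm (fun ξ => H (x, ξ)) ∞) := by
    obtain ⟨G, hG, hHG⟩ := hH
    refine ⟨fun x => eLpNorm (fun ξ => G (x, ξ)) ∞, ?_, ?_⟩
    · apply measurable_of_Iic
      intro c
      have h1 : (fun x : ℝ => eLpNorm (fun ξ => G (x, ξ)) ∞) ⁻¹' Set.Iic c =
          {x : ℝ | (volume : Measure ℝ) (Prod.mk x ⁻¹' {z : ℝ × ℝ | c < ‖G z‖ₑ}) = 0} := by
        ext x
        simp only [eLpNorm_exponent_top, eLpNormEssSup, Set.mem_preimage, Set.mem_Iic,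
          Set.mem_ofPred_eq]
        constructor
        · intro h
          have h2 : ∀ᵐ ξ : ℝ, ‖G (x, ξ)‖ₑ ≤ c :=
            (ENNReal.ae_le_essSup fun ξ : ℝ => ‖G (x, ξ)‖ₑ).mono fun ξ hξ => hξ.trans h
          rw [ae_iff] at h2
          simpa using h2
        · intro h
          have h2 : (fun ξ : ℝ => ‖G (x, ξ)‖ₑ) ≤ᵐ[volume] fun _ => c := by
            rw [EventuallyLE, ae_iff]
            simpa using h
          exact essSup_le_of_ae_le c h2
      rw [h1]
      have h3 : MeasurableSet {z : ℝ × ℝ | c < ‖G z‖ₑ} :=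
        measurableSet_lt measurable_const hG.enorm
      exact (measurable_measure_prodMk_left h3) (measurableSet_singleton 0)
    · have h4 := Measure.ae_ae_eq_curry_of_prod (μ := (volume : Measure ℝ))
        (ν := (volume : Measure ℝ)) hHG
      filter_upwards [h4] with x hx
      exact eLpNorm_congr_ae hx
  unfold mixedNorm
  rw [← lintegral_add_left' meas]
  apply lintegral_mono_ae
  filter_upwards [slice hH, slice hK] with x hx hy
  exact eLpNorm_add_le hx hy le_top

/-- The space `L¹_x(L^∞_ξ)(ℝ²)` (of functions; equality almost everywhere is not divided out). -/
def mixedL1Linf : Submodule ℂ (ℝ × ℝ → ℂ) where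
  carrier := {H | AEStronglyMeasurable H ∧ mixedNorm H < ∞}
  zero_mem' := ⟨aestronglyMeasurable_const, by
    have : mixedNorm (0 : ℝ × ℝ → ℂ) = 0 := by
      have h0 : ∀ x : ℝ, eLpNorm (fun ξ : ℝ => (0 : ℝ × ℝ → ℂ) (x, ξ)) ∞ = 0 :=
        fun _ => eLpNorm_zero
      simp only [mixedNorm, h0, lintegral_zero]
    rw [this]; exact ENNReal.zero_lt_top⟩
  add_mem' := fun hH hK => ⟨hH.1.add hK.1,
    (mixedNorm_add_le hH.1 hK.1).trans_lt (ENNReal.add_lt_top.2 ⟨hH.2, hK.2⟩)⟩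
  smul_mem' := fun c H hH => by
    have h1 : mixedNorm (c • H) = ‖c‖ₑ * mixedNorm H := by
      unfold mixedNorm
      rw [← lintegral_const_mul' _ _ enorm_ne_top]
      congr 1
      ext x
      exact eLpNorm_const_smul c (fun ξ => H (x, ξ)) ∞ volume
    refine ⟨hH.1.const_smul c, ?_⟩
    rw [h1]
    exact ENNReal.mul_lt_top enorm_lt_top hH.2

/-- The integrand `H(x,ξ) conj(V_g(F₊ ∘ lam)(x,ξ))`, where `(F₊ ∘ lam)(y) = F₊(lam y)` on `ℝ`. -/
def phaseIntegrand (ħ : ℝ) (g : 𝓢(ℝ, ℂ)) (lam : ℝ) (H : ℝ × ℝ → ℂ) (z : ℝ × ℝ) : ℂ :=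
  H z * conj (stftFun ħ g (fun y : ℝ => fresnelFun ħ (lam * y)) z.1 z.2)

/-- The functional `H ↦ ∫ H conj(V_g(F₊ ∘ lam)) dx dξ`. -/
def phaseFunctional (ħ : ℝ) (g : 𝓢(ℝ, ℂ)) (lam : ℝ) (H : ℝ × ℝ → ℂ) : ℂ :=
  ∫ z, phaseIntegrand ħ g lam H z

end FresnelSjostrand

end

open FresnelSjostrand

noncomputable section

namespace FresnelSjostrand

/-! ### Oscillatory exponentials and the unnormalised `ħ`-Fourier transform -/

/-! Up to a constant, the conjugate Gabor transform of the chirp `F₊ ∘ lam` at `(η, s)` is `chirpInt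
ħ g lam η s`. It is concentrated near the line `s = lam² η`: `exists_chirpInt_decay` bounds it by `C
(1 + (s - lam² η)²)⁻¹`, with `C` uniform for bounded `lam`. Integrating this kernel in `s` costs
only the factor `π`, so the functionals are uniformly bounded on `L¹_x(L^∞_ξ)`. Since `chirpInt` is
continuous in `lam` and `‖proj n k‖ → ‖k‖`, two nested dominated convergences give `T_n(H) → T(H)`
for every `H` (`tendsto_phaseFunctional`), without a density argument.

For the Fresnel integrals, a profile `h` in the Sjöstrand class is bounded, and its Gabor transform
with any window has an integrable majorant depending on the frequency alone
(`STFTDominated.change_window`). The Fourier transform rotates phase space by a quarter turn, so `U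
= V_γ ĥ` has a majorant in the position variable, hence lies in `L¹_x(L^∞_ξ)`. The reproducing
formula `innerSchwartz_mul_eq_integral` writes `h(y)` as a superposition of `chirpInt ħ g 0 η (y +
s)` with density `U`, and each of these is a superposition of plane waves in `y`.

With `y = κ·x`, the Fresnel integral of the plane wave `e^{(i/ħ) ζ κ·x}` is `e^{-(i/2ħ) ζ² ‖κ‖²}`.
Integrating over the plane waves therefore turns the parameter `0` into `‖κ‖`, and the Fresnel
integral of `h(κ·x)` becomes `phaseFunctional` at `‖κ‖`. This is done first with the cutoff `φ(εx)`,
`φ = 𝓕 θ`, which only smears the result over shifts of size `ε` with weight `θ` of total mass `φ(0)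
= 1` (`hasFresnelIntegral_comp_inner`). The factor `e^{-iπ/4}` compensates the phase of the
conjugated one-dimensional Fresnel constant. As `f^{(n)}(x) = h(proj n k · x)`, part (b) follows
from part (a).

For part (c), restriction to the line through `k` pushes a measure on `ℓ²` forward to one on `ℝ`
with transform `h`. The example is `arctan`: two bounded derivatives put it in the Sjöstrand class,
but for the Fourier transform `f` of a measure the Cesàro means of `f(n) - f(-n)` tend to `0`, not
to `π`. -/

/-- The oscillatory exponential `e^{(i/ħ) t}`. -/
def wave (ħ t : ℝ) : ℂ := Complex.exp (Complex.I / ħ * t)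

theorem wave_eq (ħ t : ℝ) : wave ħ t = Complex.exp ((t / ħ : ℝ) * Complex.I) := by
  unfold wave; congr 1; push_cast; ring

@[simp] theorem norm_wave (ħ t : ℝ) : ‖wave ħ t‖ = 1 := by
  rw [wave_eq, Complex.norm_exp_ofReal_mul_I]

theorem wave_add (ħ s t : ℝ) : wave ħ (s + t) = wave ħ s * wave ħ t := by
  unfold wave; rw [← Complex.exp_add]; congr 1; push_cast; ring

@[simp] theorem wave_zero (ħ : ℝ) : wave ħ 0 = 1 := by simp [wave]

@[simp] theorem conj_wave (ħ t : ℝ) : conj (wave ħ t) = wave ħ (-t) := by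
  rw [wave_eq, wave_eq, ← Complex.exp_conj]
  congr 1
  rw [map_mul, Complex.conj_ofReal, Complex.conj_I]
  push_cast; ring

@[fun_prop] theorem continuous_wave (ħ : ℝ) : Continuous (wave ħ) := by
  unfold wave; fun_prop

theorem hasDerivAt_wave (ħ t : ℝ) : HasDerivAt (wave ħ) (Complex.I / ħ * wave ħ t) t := by
  have h := ((Complex.ofRealCLM.hasDerivAt (x := t)).const_mul (Complex.I / ħ : ℂ)).cexp
  refine h.congr_deriv ?_
  simp [wave, mul_comm]

theorem hasTemperateGrowth_wave (ħ : ℝ) : (wave ħ).HasTemperateGrowth := by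
  have h1 : ∀ n : ℕ, iteratedDeriv n (wave ħ) = fun t : ℝ => (Complex.I / ħ) ^ n * wave ħ t := by
    intro n
    induction n with
    | zero => simp
    | succ n ih =>
      rw [iteratedDeriv_succ, ih]
      ext t
      rw [((hasDerivAt_wave ħ t).const_mul _).deriv]
      ring
  refine ⟨?_, fun n => ⟨0, ‖(Complex.I / ħ : ℂ) ^ n‖, fun t => ?_⟩⟩
  · exact (contDiff_const.mul Complex.ofRealCLM.contDiff).cexp
  · rw [norm_iteratedFDeriv_eq_norm_iteratedDeriv, h1 n, norm_mul]
    simp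

/-- Fubini's theorem for a bounded kernel. -/
theorem integral_mul_integral_swap {α β : Type*} [MeasurableSpace α] [MeasurableSpace β]
    {μ : Measure α} {ν : Measure β} [SFinite μ] [SFinite ν] {A : α → ℂ} {B : β → ℂ}
    (hA : Integrable A μ) (hB : Integrable B ν) {q : α → β → ℂ} {C : ℝ}
    (hq : AEStronglyMeasurable (Function.uncurry q) (μ.prod ν)) (hC : ∀ a b, ‖q a b‖ ≤ C) :
    ∫ a, A a * ∫ b, B b * q a b ∂ν ∂μ = ∫ b, B b * ∫ a, A a * q a b ∂μ ∂ν := by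
  simp_rw [← integral_const_mul]
  rw [integral_integral_swap]
  · refine integral_congr_ae (.of_forall fun b => integral_congr_ae (.of_forall fun a => ?_))
    simp only; ring
  · have h := (hA.mul_prod hB).bdd_mul hq (.of_forall fun z => hC z.1 z.2)
    refine h.congr (.of_forall fun z => ?_)
    simp only [Function.uncurry]; ring

section Euclidean

variable {E : Type*} [NormedAddCommGroup E] [InnerProductSpace ℝ E] [FiniteDimensional ℝ E]
  [MeasurableSpace E] [BorelSpace E]

/-- The unnormalised Fourier transform `ξ ↦ ∫ f(y) e^{-(i/ħ) ξ·y} dy`. -/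
def oscInt (ħ : ℝ) (f : E → ℂ) (ξ : E) : ℂ := ∫ y, f y * wave ħ (-(inner ℝ ξ y : ℝ))

theorem oscInt_eq_fourier (ħ : ℝ) (f : E → ℂ) (ξ : E) :
    oscInt ħ f ξ = 𝓕 f ((2 * Real.pi * ħ)⁻¹ • ξ) := by
  rw [Real.fourier_eq', oscInt]
  refine integral_congr_ae (.of_forall fun y => ?_)
  simp only [smul_eq_mul, inner_smul_right, wave_eq]
  rw [mul_comm, real_inner_comm]
  congr 3
  have := Real.pi_ne_zero
  field_simp

theorem norm_oscInt_le (ħ : ℝ) (f : E → ℂ) (ξ : E) : ‖oscInt ħ f ξ‖ ≤ ∫ y, ‖f y‖ := by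
  refine (norm_integral_le_integral_norm _).trans (le_of_eq ?_)
  simp

theorem continuous_oscInt (ħ : ℝ) {f : E → ℂ} (hf : Integrable f) :
    Continuous (oscInt ħ f) := by
  unfold oscInt
  refine continuous_of_dominated (bound := fun y => ‖f y‖) (fun ξ => ?_) (fun ξ => ?_) hf.norm ?_
  · exact hf.1.mul (by fun_prop : Continuous fun y => wave ħ (-(inner ℝ ξ y : ℝ))).aestronglyMeasurable
  · exact .of_forall fun y => by simp
  · exact .of_forall fun y => by fun_prop

theorem oscInt_comp_sub (ħ : ℝ) (f : E → ℂ) (x ξ : E) :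
    oscInt ħ (fun y => f (y - x)) ξ = wave ħ (-(inner ℝ ξ x : ℝ)) * oscInt ħ f ξ := by
  unfold oscInt
  rw [← integral_add_right_eq_self _ x, ← integral_const_mul]
  refine integral_congr_ae (.of_forall fun y => ?_)
  simp only [add_sub_cancel_right, inner_add_right, neg_add, wave_add]
  ring

theorem stftFun_eq (ħ : ℝ) (g : 𝓢(E, ℂ)) (f : E → ℂ) (x ξ : E) :
    stftFun ħ g f x ξ = planckConst ħ E * oscInt ħ (fun y => f y * conj (g (y - x))) ξ := by
  unfold stftFun oscInt
  rw [← integral_const_mul]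
  refine integral_congr_ae (.of_forall fun y => ?_)
  have h1 : conj (planckConst ħ E) = planckConst ħ E := by
    simp only [planckConst, Complex.conj_ofReal]
  have h2 : Complex.exp (Complex.I / ħ * (inner ℝ ξ y : ℝ)) = wave ħ (inner ℝ ξ y : ℝ) := rfl
  simp only [phaseShift_apply, map_mul, h1, h2, conj_wave]
  ring

end Euclidean

/-! ### Fourier inversion on the line in the `ħ`-normalisation. -/

theorem planckConst_sq {ħ : ℝ} (hħ : 0 < ħ) : planckConst ħ ℝ ^ 2 = ((2 * Real.pi * ħ)⁻¹ : ℝ) := by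
  rw [planckConst, ← Complex.ofReal_pow, ← Real.rpow_natCast, ← Real.rpow_mul (by positivity)]
  simp [Real.rpow_neg_one]

theorem planckConst_ne_zero {ħ : ℝ} (hħ : 0 < ħ) : planckConst ħ ℝ ≠ 0 := by
  intro h
  have h1 := planckConst_sq hħ
  rw [h, zero_pow two_ne_zero] at h1
  have h2 : (2 * Real.pi * ħ)⁻¹ ≠ 0 := by positivity
  exact h2 (by exact_mod_cast h1.symm)

theorem oscInt_inversion {ħ : ℝ} (hħ : 0 < ħ) {f : ℝ → ℂ} (hc : Continuous f)
    (hf : Integrable f) (hF : Integrable (oscInt ħ f)) (y : ℝ) :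
    f y = planckConst ħ ℝ ^ 2 * ∫ η, oscInt ħ f η * wave ħ (η * y) := by
  have hpos : 0 < 2 * Real.pi * ħ := by positivity
  have h1 : ∀ ζ, 𝓕 f ζ = oscInt ħ f ((2 * Real.pi * ħ) * ζ) := by
    intro ζ
    rw [oscInt_eq_fourier]
    simp only [smul_eq_mul]
    field_simp
  have h2 : Integrable (𝓕 f) := by
    have : 𝓕 f = fun ζ => oscInt ħ f ((2 * Real.pi * ħ) * ζ) := funext h1
    rw [this]
    exact hF.comp_mul_left' hpos.ne'
  have h3 := congrFun (hc.fourierInv_fourier_eq hf h2) y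
  rw [Real.fourierInv_eq'] at h3
  rw [← h3, planckConst_sq hħ]
  have h4 := Measure.integral_comp_mul_left (fun η => oscInt ħ f η * wave ħ (η * y)) (2 * Real.pi * ħ)
  rw [abs_of_pos (by positivity), Complex.real_smul] at h4
  rw [← h4]
  refine integral_congr_ae (.of_forall fun ζ => ?_)
  simp only [smul_eq_mul, h1, wave_eq]
  rw [mul_comm]
  congr 3
  simp only [RCLike.inner_apply, conj_trivial]
  have := Real.pi_ne_zero
  field_simp

/-! ### Decay of Fourier transforms -/

theorem integrable_one_add_sq_mul_norm (g : 𝓢(ℝ, ℂ)) :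
    Integrable fun y : ℝ => (1 + y ^ 2) * ‖g y‖ := by
  have h1 := g.integrable_pow_mul volume 2
  have h2 := (g.integrable (μ := volume)).norm
  refine (h2.add h1).congr (.of_forall fun y => ?_)
  simp only [Pi.add_apply, Real.norm_eq_abs, sq_abs]
  ring

/-- Two derivatives of `f` become the factor `-ξ²/ħ²` on the transform side. -/
theorem one_add_sq_mul_norm_oscInt_le {ħ : ℝ} (hħ : 0 < ħ) (f : 𝓢(ℝ, ℂ)) (ξ : ℝ) :
    (1 + ξ ^ 2) * ‖oscInt ħ f ξ‖ ≤
      (∫ y, ‖f y‖) + ħ ^ 2 * ∫ y, ‖deriv (deriv f) y‖ := by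
  have d1 : (deriv f : ℝ → ℂ) = SchwartzMap.derivCLM ℂ ℂ f := by
    ext x; rw [SchwartzMap.derivCLM_apply]
  have key : ∀ φ : 𝓢(ℝ, ℂ), oscInt ħ (deriv φ) ξ = (Complex.I * ξ / ħ) * oscInt ħ φ ξ := by
    intro φ
    have d : (deriv φ : ℝ → ℂ) = SchwartzMap.derivCLM ℂ ℂ φ := by
      ext x; rw [SchwartzMap.derivCLM_apply]
    rw [oscInt_eq_fourier, oscInt_eq_fourier, Real.fourier_deriv φ.integrable φ.differentiable
      (by rw [d]; exact (SchwartzMap.derivCLM ℂ ℂ φ).integrable)]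
    simp only [smul_eq_mul]
    push_cast
    have h1 : (ħ : ℂ) ≠ 0 := by exact_mod_cast hħ.ne'
    have h2 : (Real.pi : ℂ) ≠ 0 := by exact_mod_cast Real.pi_ne_zero
    field_simp
  have h2 : oscInt ħ (deriv (deriv f)) ξ = -(ξ ^ 2 / ħ ^ 2 : ℝ) * oscInt ħ f ξ := by
    rw [d1, key, ← d1, key]
    push_cast
    ring_nf
    rw [Complex.I_sq]; ring
  have h3 : ξ ^ 2 * ‖oscInt ħ f ξ‖ = ħ ^ 2 * ‖oscInt ħ (deriv (deriv f)) ξ‖ := by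
    rw [h2, norm_mul, norm_neg, Complex.norm_real, Real.norm_of_nonneg (by positivity)]
    field_simp
  rw [add_mul, one_mul, h3]
  gcongr
  · exact norm_oscInt_le ħ f ξ
  · exact norm_oscInt_le ħ _ ξ

/-- The point is uniformity: `C` depends on `ħ` and `g` only, and the amplitude `a` enters through
the single number `A`. By Leibniz, two derivatives of `a g` are controlled by weighted integrals of
`g` and its first two derivatives. Quadratic growth is allowed because second derivatives of chirps
grow quadratically, and because translated windows satisfy such a bound by Peetre's inequality. -/
theorem exists_oscInt_decay {ħ : ℝ} (hħ : 0 < ħ) (g : 𝓢(ℝ, ℂ)) :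
    ∃ C : ℝ, 0 ≤ C ∧ ∀ a : ℝ → ℂ, a.HasTemperateGrowth → ∀ A : ℝ,
      (∀ y, ‖a y‖ ≤ A * (1 + y ^ 2)) → (∀ y, ‖deriv a y‖ ≤ A * (1 + y ^ 2)) →
      (∀ y, ‖deriv (deriv a) y‖ ≤ A * (1 + y ^ 2)) →
      ∀ ξ, ‖oscInt ħ (fun y => a y * g y) ξ‖ ≤ C * A * (1 + ξ ^ 2)⁻¹ := by
  set g1 := SchwartzMap.derivCLM ℂ ℂ g with hg1
  set g2 := SchwartzMap.derivCLM ℂ ℂ g1 with hg2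
  have d1 : ∀ x, HasDerivAt g (g1 x) x := fun x => by
    rw [hg1, SchwartzMap.derivCLM_apply]; exact g.hasDerivAt x
  have d2 : ∀ x, HasDerivAt g1 (g2 x) x := fun x => by
    rw [hg2, SchwartzMap.derivCLM_apply]; exact g1.hasDerivAt x
  have i0 := integrable_one_add_sq_mul_norm g
  have i1 := integrable_one_add_sq_mul_norm g1
  have i2 := integrable_one_add_sq_mul_norm g2
  have iS := (i0.add (i1.const_mul 2)).add i2
  refine ⟨(∫ y, (1 + y ^ 2) * ‖g y‖) + ħ ^ 2 *
    ∫ y, ((1 + y ^ 2) * ‖g y‖ + 2 * ((1 + y ^ 2) * ‖g1 y‖) + (1 + y ^ 2) * ‖g2 y‖), ?_, ?_⟩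
  · refine add_nonneg (integral_nonneg fun y => ?_)
      (mul_nonneg (sq_nonneg _) (integral_nonneg fun y => ?_))
    all_goals simp only [Pi.zero_apply]; positivity
  intro a ha A b0 b1 b2 ξ
  have ca : ContDiff ℝ 2 a := contDiff_infty.1 ha.1 2
  have e1 : ∀ x, HasDerivAt a (deriv a x) x := fun x =>
    (ca.differentiable (by norm_num)).differentiableAt.hasDerivAt
  have e2 : ∀ x, HasDerivAt (deriv a) (deriv (deriv a) x) x := fun x => by
    have : ContDiff ℝ 1 (deriv a) := by
      have := (contDiff_succ_iff_deriv (n := 1) (f := a)).1 (by simpa using! ca)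
      exact this.2.2
    exact (this.differentiable (by norm_num)).differentiableAt.hasDerivAt
  set F := SchwartzMap.smulLeftCLM ℂ a g with hF
  have hFe : (F : ℝ → ℂ) = fun y => a y * g y := by
    ext y; rw [hF, SchwartzMap.smulLeftCLM_apply_apply ha]; rfl
  have f1 : deriv F = fun y => deriv a y * g y + a y * g1 y := by
    ext y; rw [hFe]; exact ((e1 y).mul (d1 y)).deriv
  have f2 : deriv (deriv F) = fun y => (deriv (deriv a) y * g y + deriv a y * g1 y) +
      (deriv a y * g1 y + a y * g2 y) := by
    ext y; rw [f1]; exact (((e2 y).mul (d1 y)).add ((e1 y).mul (d2 y))).deriv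
  have h := one_add_sq_mul_norm_oscInt_le hħ F ξ
  have k0 : (∫ y, ‖F y‖) ≤ A * ∫ y, (1 + y ^ 2) * ‖g y‖ := by
    rw [← integral_const_mul]
    refine integral_mono_of_nonneg (.of_forall fun y => norm_nonneg _) (i0.const_mul A)
      (.of_forall fun y => ?_)
    simp only [hFe, norm_mul]
    calc ‖a y‖ * ‖g y‖ ≤ (A * (1 + y ^ 2)) * ‖g y‖ := by gcongr; exact b0 y
      _ = _ := by ring
  have k2 : (∫ y, ‖deriv (deriv F) y‖) ≤ A *
      ∫ y, ((1 + y ^ 2) * ‖g y‖ + 2 * ((1 + y ^ 2) * ‖g1 y‖) + (1 + y ^ 2) * ‖g2 y‖) := by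
    rw [← integral_const_mul]
    refine integral_mono_of_nonneg (.of_forall fun y => norm_nonneg _) (iS.const_mul A)
      (.of_forall fun y => ?_)
    simp only [f2]
    calc _ ≤ (‖deriv (deriv a) y‖ * ‖g y‖ + ‖deriv a y‖ * ‖g1 y‖) +
          (‖deriv a y‖ * ‖g1 y‖ + ‖a y‖ * ‖g2 y‖) := by
          refine (norm_add_le _ _).trans (add_le_add ?_ ?_) <;>
            · refine (norm_add_le _ _).trans (le_of_eq ?_)
              simp only [norm_mul]
      _ ≤ ((A * (1 + y ^ 2)) * ‖g y‖ + (A * (1 + y ^ 2)) * ‖g1 y‖) +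
          ((A * (1 + y ^ 2)) * ‖g1 y‖ + (A * (1 + y ^ 2)) * ‖g2 y‖) := by
          gcongr
          exacts [b2 y, b1 y, b1 y, b0 y]
      _ = _ := by ring
  have hpos : 0 < 1 + ξ ^ 2 := by positivity
  rw [← hFe, ← div_eq_mul_inv, le_div_iff₀ hpos, mul_comm]
  refine h.trans ?_
  calc _ ≤ (A * ∫ y, (1 + y ^ 2) * ‖g y‖) + ħ ^ 2 * (A *
      ∫ y, ((1 + y ^ 2) * ‖g y‖ + 2 * ((1 + y ^ 2) * ‖g1 y‖) + (1 + y ^ 2) * ‖g2 y‖)) := by gcongr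
    _ = _ := by ring

/-- Peetre's inequality; it trades a shift of the decaying kernel for a polynomial factor. -/
theorem inv_one_add_sq_add_le (a b : ℝ) :
    (1 + (a + b) ^ 2)⁻¹ ≤ 2 * (1 + b ^ 2) * (1 + a ^ 2)⁻¹ := by
  rw [← div_eq_mul_inv, inv_eq_one_div, div_le_div_iff₀ (by positivity) (by positivity)]
  nlinarith [sq_nonneg (a + 2 * b), sq_nonneg (a * b + b ^ 2), sq_nonneg b, sq_nonneg (a + b),
    mul_nonneg (sq_nonneg b) (sq_nonneg (a + b))]

/-! ### Distributions given by bounded continuous functions -/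

section Euclidean

variable {E : Type*} [NormedAddCommGroup E] [InnerProductSpace ℝ E]

@[simp] theorem conjSchwartz_apply (φ : 𝓢(E, ℂ)) (x : E) : conjSchwartz φ x = conj (φ x) := rfl

variable [FiniteDimensional ℝ E] [MeasurableSpace E] [BorelSpace E]

theorem Represents.stft_eq {f : E → ℂ} {u : 𝓢'(E, ℂ)} (hu : Represents f u) (ħ : ℝ)
    (g : 𝓢(E, ℂ)) (x ξ : E) : stft ħ g u x ξ = stftFun ħ g f x ξ := by
  rw [stft, (hu _).2, stftFun]
  simp only [conjSchwartz_apply, mul_comm]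

theorem Represents.toDist_eq {f : E → ℂ} {u : 𝓢'(E, ℂ)} (hu : Represents f u) : toDist f = u := by
  have h : ∃ u : 𝓢'(E, ℂ), Represents f u := ⟨u, hu⟩
  rw [toDist, dif_pos h]
  refine DFunLike.ext _ _ fun φ => ?_
  rw [(h.choose_spec φ).2, (hu φ).2]

theorem exists_represents_of_bounded {f : E → ℂ} (hc : Continuous f) {C : ℝ}
    (hC : ∀ x, ‖f x‖ ≤ C) : ∃ u : 𝓢'(E, ℂ), Represents f u := by
  have hm : MemLp f ⊤ (volume : Measure E) :=
    memLp_top_of_bound hc.aestronglyMeasurable C (.of_forall hC)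
  refine ⟨Lp.toTemperedDistribution hm.toLp, fun φ => ⟨?_, ?_⟩⟩
  · exact φ.integrable.mul_bdd hc.aestronglyMeasurable (.of_forall hC)
  · rw [Lp.toTemperedDistribution_apply]
    refine integral_congr_ae ?_
    filter_upwards [hm.coeFn_toLp] with x hx
    rw [hx, smul_eq_mul]

theorem integrable_mul_conj_comp_sub {f : E → ℂ} (hf : ∀ φ : 𝓢(E, ℂ), Integrable fun x => φ x * f x)
    (g : 𝓢(E, ℂ)) (x : E) : Integrable fun y => f y * conj (g (y - x)) := by
  refine (hf (conjSchwartz (SchwartzMap.compSubConstCLM ℂ x g))).congr (.of_forall fun y => ?_)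
  simp [mul_comm]

theorem integrable_schwartz_mul {f : E → ℂ} (hc : Continuous f) {C : ℝ} (hC : ∀ x, ‖f x‖ ≤ C)
    (φ : 𝓢(E, ℂ)) : Integrable fun x => φ x * f x :=
  φ.integrable.mul_bdd hc.aestronglyMeasurable (.of_forall hC)

theorem continuous_stftFun (ħ : ℝ) {f : E → ℂ}
    (hf : ∀ φ : 𝓢(E, ℂ), Integrable fun x => φ x * f x) (g : 𝓢(E, ℂ)) (x : E) :
    Continuous (stftFun ħ g f x) := by
  have : stftFun ħ g f x = fun ξ => planckConst ħ E * oscInt ħ (fun y => f y * conj (g (y - x))) ξ :=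
    funext fun ξ => stftFun_eq ħ g f x ξ
  rw [this]
  exact continuous_const.mul (continuous_oscInt ħ (integrable_mul_conj_comp_sub hf g x))

end Euclidean

/-! ### The Sjöstrand class on the line -/

/-- The Gabor transform with window `g` of the function `h` on the line is dominated by an integrable
function of the frequency. -/
def STFTDominated (ħ : ℝ) (g : 𝓢(ℝ, ℂ)) (h : ℝ → ℂ) : Prop :=
  ∃ W : ℝ → ℝ, Integrable W ∧ ∀ x ξ, ‖stftFun ħ g h x ξ‖ ≤ W ξ

/-- For fixed `x`, the Gabor transform is the Fourier transform of `h` times a translated conjugate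
window, so Fourier inversion applies in the frequency variable alone. -/
theorem mul_conj_eq_integral_stftFun {ħ : ℝ} (hħ : 0 < ħ) {h : ℝ → ℂ} (hc : Continuous h)
    (hh : ∀ φ : 𝓢(ℝ, ℂ), Integrable fun x => φ x * h x) (g : 𝓢(ℝ, ℂ)) (x : ℝ)
    (hi : Integrable (stftFun ħ g h x)) (y : ℝ) :
    h y * conj (g (y - x)) = planckConst ħ ℝ * ∫ η, stftFun ħ g h x η * wave ħ (η * y) := by
  have hF : oscInt ħ (fun y => h y * conj (g (y - x))) =
      fun η => (planckConst ħ ℝ)⁻¹ * stftFun ħ g h x η := by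
    ext η
    rw [stftFun_eq, inv_mul_cancel_left₀ (planckConst_ne_zero hħ)]
  have h1 := oscInt_inversion hħ (f := fun y => h y * conj (g (y - x)))
    (hc.mul (Complex.continuous_conj.comp (g.continuous.comp (by fun_prop))))
    (integrable_mul_conj_comp_sub hh g x) (by rw [hF]; exact hi.const_mul _) y
  rw [h1, hF]
  simp only [mul_assoc]
  rw [integral_const_mul, ← mul_assoc, sq, mul_assoc (planckConst ħ ℝ), mul_inv_cancel₀
    (planckConst_ne_zero hħ), mul_one]

/-- Choose `t` with `g t ≠ 0` and use the inversion formula with the window centred at `y - t`: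
there the window contributes the fixed nonzero factor `conj (g t)`. -/
theorem exists_bound_of_sjostrandNorm_lt_top {ħ : ℝ} (hħ : 0 < ħ) {h : ℝ → ℂ} (hc : Continuous h)
    (hh : ∀ φ : 𝓢(ℝ, ℂ), Integrable fun x => φ x * h x) {g : 𝓢(ℝ, ℂ)} (hg : g ≠ 0)
    (hfin : ∫⁻ ξ, ⨆ x, ‖stftFun ħ g h x ξ‖ₑ < ∞) : ∃ C, ∀ y, ‖h y‖ ≤ C := by
  obtain ⟨t, ht⟩ : ∃ t, g t ≠ 0 := by
    by_contra! hcon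
    exact hg (SchwartzMap.ext hcon)
  set M := (∫⁻ ξ, ⨆ x, ‖stftFun ħ g h x ξ‖ₑ).toReal with hM
  refine ⟨‖planckConst ħ ℝ‖ * M / ‖g t‖, fun y => ?_⟩
  have hle : ∫⁻ ξ, ‖stftFun ħ g h (y - t) ξ‖ₑ ≤ ∫⁻ ξ, ⨆ x, ‖stftFun ħ g h x ξ‖ₑ :=
    lintegral_mono fun ξ => le_iSup (fun x => ‖stftFun ħ g h x ξ‖ₑ) (y - t)
  have hi : Integrable (stftFun ħ g h (y - t)) :=
    ⟨(continuous_stftFun ħ hh g _).aestronglyMeasurable, hle.trans_lt hfin⟩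
  have h1 := mul_conj_eq_integral_stftFun hħ hc hh g (y - t) hi y
  rw [sub_sub_cancel] at h1
  rw [le_div_iff₀ (norm_pos_iff.2 ht)]
  calc ‖h y‖ * ‖g t‖ = ‖h y * conj (g t)‖ := by simp
    _ ≤ ‖planckConst ħ ℝ‖ * ∫ η, ‖stftFun ħ g h (y - t) η * wave ħ (η * y)‖ := by
        rw [h1, norm_mul]; gcongr; exact norm_integral_le_integral_norm _
    _ = ‖planckConst ħ ℝ‖ * (∫⁻ ξ, ‖stftFun ħ g h (y - t) ξ‖ₑ).toReal := by
        simp only [norm_mul, norm_wave, mul_one]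
        rw [integral_norm_eq_lintegral_enorm hi.1]
    _ ≤ _ := by
        gcongr
        exact ENNReal.toReal_mono hfin.ne hle

/-- The majorant is the supremum over `x`. It is measurable as a lower semicontinuous supremum of
continuous functions, and boundedness of `h` makes it finite at every frequency, so that `toReal`
loses nothing. -/
theorem STFTDominated.of_sjostrandNorm_lt_top {ħ : ℝ} {h : ℝ → ℂ} (hc : Continuous h)
    {C : ℝ} (hC : ∀ y, ‖h y‖ ≤ C) {g : 𝓢(ℝ, ℂ)}
    (hfin : ∫⁻ ξ, ⨆ x, ‖stftFun ħ g h x ξ‖ₑ < ∞) : STFTDominated ħ g h := by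
  have hh := integrable_schwartz_mul hc hC
  have hbd : ∀ x ξ, ‖stftFun ħ g h x ξ‖ ≤ ‖planckConst ħ ℝ‖ * (C * ∫ y, ‖g y‖) := by
    intro x ξ
    rw [stftFun_eq, norm_mul]
    gcongr
    refine (norm_oscInt_le _ _ _).trans ?_
    rw [← integral_sub_right_eq_self (fun y => ‖g y‖) x, ← integral_const_mul]
    refine integral_mono_of_nonneg (.of_forall fun y => norm_nonneg _)
      ((g.integrable.comp_sub_right x).norm.const_mul C) (.of_forall fun y => ?_)
    simp only [norm_mul, RCLike.norm_conj]
    gcongr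
    exact hC y
  have hm : Measurable fun ξ => ⨆ x, ‖stftFun ħ g h x ξ‖ₑ :=
    (lowerSemicontinuous_iSup fun x =>
      (continuous_stftFun ħ hh g x).enorm.lowerSemicontinuous).measurable
  have hne : ∀ ξ, (⨆ x, ‖stftFun ħ g h x ξ‖ₑ) ≠ ∞ := fun ξ => by
    refine ((iSup_le fun x => ?_).trans_lt
      (ENNReal.ofReal_lt_top (r := ‖planckConst ħ ℝ‖ * (C * ∫ y, ‖g y‖)))).ne
    rw [← ofReal_norm]
    exact ENNReal.ofReal_le_ofReal (hbd x ξ)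
  refine ⟨fun ξ => (⨆ x, ‖stftFun ħ g h x ξ‖ₑ).toReal,
    integrable_toReal_of_lintegral_ne_top hm.aemeasurable hfin.ne, fun x ξ => ?_⟩
  rw [← toReal_enorm]
  exact ENNReal.toReal_mono (hne ξ) (le_iSup (fun x => ‖stftFun ħ g h x ξ‖ₑ) x)

/-- By translation only `s = t - x` matters. Treating the shifted `g` as amplitude in
`exists_oscInt_decay`, Peetre's inequality converts its decay away from `s` into the small factor
`(1 + s²)⁻¹` times admissible growth. -/
theorem exists_window_decay {ħ : ℝ} (hħ : 0 < ħ) (g γ : 𝓢(ℝ, ℂ)) :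
    ∃ C : ℝ, 0 ≤ C ∧ ∀ t x ξ : ℝ, ‖oscInt ħ (fun y => g (y - t) * conj (γ (y - x))) ξ‖ ≤
      C * (1 + (t - x) ^ 2)⁻¹ * (1 + ξ ^ 2)⁻¹ := by
  obtain ⟨C, hC0, hC⟩ := exists_oscInt_decay hħ (conjSchwartz γ)
  have bound : ∀ f : 𝓢(ℝ, ℂ), ∃ B : ℝ, ∀ y, ‖f y‖ ≤ B * (1 + y ^ 2)⁻¹ := by
    intro f
    refine ⟨SchwartzMap.seminorm ℝ 0 0 f + SchwartzMap.seminorm ℝ 2 0 f, fun y => ?_⟩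
    rw [← div_eq_mul_inv, le_div_iff₀ (by positivity)]
    have h0 := f.norm_le_seminorm ℝ y
    have h2 := f.norm_pow_mul_le_seminorm ℝ 2 y
    rw [Real.norm_eq_abs, sq_abs] at h2
    linarith
  obtain ⟨B0, hB0⟩ := bound g
  obtain ⟨B1, hB1⟩ := bound (SchwartzMap.derivCLM ℂ ℂ g)
  obtain ⟨B2, hB2⟩ := bound (SchwartzMap.derivCLM ℂ ℂ (SchwartzMap.derivCLM ℂ ℂ g))
  set B := max B0 (max B1 B2) with hB
  have hBpos : 0 ≤ B := by
    have := (norm_nonneg _).trans (hB0 0)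
    norm_num at this
    exact this.trans (le_max_left _ _)
  refine ⟨C * (B * 2), by positivity, fun t x ξ => ?_⟩
  have e1 : (fun y => g (y - t) * conj (γ (y - x))) =
      fun y => (fun z => g (z - (t - x)) * conjSchwartz γ z) (y - x) := by
    ext y; simp only [conjSchwartz_apply]; congr 2; ring
  rw [e1, oscInt_comp_sub ħ (fun z => g (z - (t - x)) * conjSchwartz γ z), norm_mul, norm_wave, one_mul]
  set s := t - x with hs
  have shift : ∀ {b : ℝ} {y : ℝ} {z : ℂ}, b ≤ B → ‖z‖ ≤ b * (1 + (y - s) ^ 2)⁻¹ →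
      ‖z‖ ≤ B * 2 * (1 + s ^ 2)⁻¹ * (1 + y ^ 2) := by
    intro b y z hb hz
    have h1 := inv_one_add_sq_add_le (-s) y
    rw [neg_sq] at h1
    calc ‖z‖ ≤ B * (1 + (-s + y) ^ 2)⁻¹ := by
          refine hz.trans ?_
          rw [show -s + y = y - s by ring]
          gcongr
      _ ≤ B * (2 * (1 + y ^ 2) * (1 + s ^ 2)⁻¹) := by gcongr
      _ = _ := by ring
  have d1 : deriv (fun z => g (z - s)) = fun z => SchwartzMap.derivCLM ℂ ℂ g (z - s) := by
    ext z; rw [deriv_comp_sub_const, SchwartzMap.derivCLM_apply]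
  have d2 : deriv (deriv fun z => g (z - s)) =
      fun z => SchwartzMap.derivCLM ℂ ℂ (SchwartzMap.derivCLM ℂ ℂ g) (z - s) := by
    rw [d1]; ext z; rw [deriv_comp_sub_const, SchwartzMap.derivCLM_apply]
  have h := hC (fun z => g (z - s))
    (SchwartzMap.compSubConstCLM ℂ s g).hasTemperateGrowth (B * 2 * (1 + s ^ 2)⁻¹)
    (fun y => shift (le_max_left _ _) (hB0 _))
    (fun y => by rw [d1]; exact shift ((le_max_left _ _).trans (le_max_right _ _)) (hB1 _))
    (fun y => by rw [d2]; exact shift ((le_max_right _ _).trans (le_max_right _ _)) (hB2 _)) ξ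
  refine h.trans (le_of_eq ?_)
  ring

theorem integrable_norm_sq (g : 𝓢(ℝ, ℂ)) : Integrable fun t => ‖g t‖ ^ 2 :=
  (memLp_two_iff_integrable_sq_norm g.continuous.aestronglyMeasurable).1 (g.memLp 2)

theorem integral_norm_sq_pos {g : 𝓢(ℝ, ℂ)} (hg : g ≠ 0) : 0 < ∫ t, ‖g t‖ ^ 2 := by
  obtain ⟨t, ht⟩ : ∃ t, g t ≠ 0 := by
    by_contra! hcon
    exact hg (SchwartzMap.ext hcon)
  exact integral_pos_of_integrable_nonneg_nonzero (g.continuous.norm.pow 2) (integrable_norm_sq g)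
    (fun t => sq_nonneg _) (x := t) (by simpa using ht)

theorem oscInt_real (ħ : ℝ) (f : ℝ → ℂ) (ξ : ℝ) :
    oscInt ħ f ξ = ∫ y, f y * wave ħ (-(ξ * y)) := by
  simp only [oscInt, RCLike.inner_apply, conj_trivial, mul_comm ξ]

/-- Insert `1 = N⁻¹ ∫ |g(y - t)|² dt` into the transform with window `γ` and expand `h(y) conj(g(y -
t))` by inversion. What remains is `V_g h(t, η)` against the cross transform of `g` and `γ`, which
decays in both `t - x` and `ξ - η`; the new majorant is a multiple of the convolution of `W` with
`(1 + ξ²)⁻¹`. -/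
theorem STFTDominated.change_window {ħ : ℝ} (hħ : 0 < ħ) {h : ℝ → ℂ} (hc : Continuous h)
    {B : ℝ} (hB : ∀ y, ‖h y‖ ≤ B) {g : 𝓢(ℝ, ℂ)} (hg : g ≠ 0) (hd : STFTDominated ħ g h)
    (γ : 𝓢(ℝ, ℂ)) : STFTDominated ħ γ h := by
  obtain ⟨W, hW, hWb⟩ := hd
  obtain ⟨C, hC0, hC⟩ := exists_window_decay hħ g γ
  have hh := integrable_schwartz_mul hc hB
  set c := planckConst ħ ℝ with hcdef
  set N := ∫ t, ‖g t‖ ^ 2 with hN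
  have hNpos : 0 < N := integral_norm_sq_pos hg
  have hK := integrable_inv_one_add_sq
  set K : ℝ → ℝ := fun x => (1 + x ^ 2)⁻¹ with hKdef
  have hWK : ∀ ξ, Integrable fun η => W η * K (ξ - η) := fun ξ => by
    refine hW.mul_bdd (c := 1) ?_ (.of_forall fun η => ?_)
    · exact (hK.comp_sub_left ξ).1
    · rw [Real.norm_of_nonneg (by positivity)]
      exact inv_le_one_of_one_le₀ (by nlinarith [sq_nonneg (ξ - η)])
  set D : ℝ → ℝ := fun ξ => ∫ η, W η * K (ξ - η) with hD
  have hDi : Integrable D := hW.integrable_convolution (ContinuousLinearMap.mul ℝ ℝ) hK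
  refine ⟨fun ξ => N⁻¹ * (‖c‖ * (‖c‖ * C * (∫ t, K t))) * D ξ, hDi.const_mul _, fun x ξ => ?_⟩
  have hγ : Integrable fun y => conj (γ (y - x)) :=
    (conjSchwartz (SchwartzMap.compSubConstCLM ℂ x γ)).integrable
  have hgt : ∀ t, Continuous fun y => g (y - t) := fun t => g.continuous.comp (by fun_prop)
  obtain ⟨Mg, hMg⟩ : ∃ M, ∀ y, ‖g y‖ ≤ M := ⟨_, g.norm_le_seminorm ℝ⟩
  set J : ℝ → ℂ := fun t => ∫ y, (h y * conj (γ (y - x)) * wave ħ (-(ξ * y))) *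
    (conj (g (y - t)) * g (y - t)) with hJ
  have hA : Integrable fun y => h y * conj (γ (y - x)) * wave ħ (-(ξ * y)) := by
    refine (integrable_mul_conj_comp_sub hh γ x).mul_bdd (c := 1) ?_ (.of_forall fun y => by simp)
    exact (by fun_prop : Continuous fun y => wave ħ (-(ξ * y))).aestronglyMeasurable
  have hJb : ∀ t, ‖J t‖ ≤ ‖c‖ * C * D ξ * K (t - x) := by
    intro t
    have hV : Integrable (stftFun ħ g h t) :=
      hW.mono' (continuous_stftFun ħ hh g t).aestronglyMeasurable (.of_forall (hWb t))
    have hb : Integrable fun y => g (y - t) * conj (γ (y - x)) :=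
      hγ.bdd_mul (hgt t).aestronglyMeasurable (.of_forall fun y => hMg _)
    have hb' : Integrable fun y => g (y - t) * conj (γ (y - x)) * wave ħ (-(ξ * y)) := by
      refine hb.mul_bdd (c := 1) ?_ (.of_forall fun y => by simp)
      exact (by fun_prop : Continuous fun y => wave ħ (-(ξ * y))).aestronglyMeasurable
    have h1 : J t = c * ∫ y, (g (y - t) * conj (γ (y - x)) * wave ħ (-(ξ * y))) *
        ∫ η, stftFun ħ g h t η * wave ħ (η * y) := by
      rw [← integral_const_mul]
      refine integral_congr_ae (.of_forall fun y => ?_)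
      have := mul_conj_eq_integral_stftFun hħ hc hh g t hV y
      simp only
      linear_combination (g (y - t) * conj (γ (y - x)) * wave ħ (-(ξ * y))) * this
    have h2 := integral_mul_integral_swap hb' hV (q := fun y η => wave ħ (η * y)) (C := 1)
      (by fun_prop : Continuous (Function.uncurry fun y η : ℝ => wave ħ (η * y))).aestronglyMeasurable
      (fun y η => by simp)
    have h3 : ∀ η, (∫ y, g (y - t) * conj (γ (y - x)) * wave ħ (-(ξ * y)) * wave ħ (η * y)) =
        oscInt ħ (fun y => g (y - t) * conj (γ (y - x))) (ξ - η) := by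
      intro η
      rw [oscInt_real]
      refine integral_congr_ae (.of_forall fun y => ?_)
      simp only [mul_assoc, ← wave_add]
      congr 3
      ring
    rw [h1, h2, norm_mul, mul_assoc, mul_assoc]
    gcongr
    have h4 : C * (D ξ * K (t - x)) = ∫ η, C * K (t - x) * (W η * K (ξ - η)) := by
      rw [integral_const_mul]; ring
    rw [h4]
    refine norm_integral_le_of_norm_le ((hWK ξ).const_mul _) (.of_forall fun η => ?_)
    rw [h3, norm_mul]
    calc _ ≤ W η * (C * K (t - x) * K (ξ - η)) :=
          mul_le_mul (hWb t η) (hC t x (ξ - η)) (norm_nonneg _) ((norm_nonneg _).trans (hWb t η))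
      _ = _ := by ring
  -- The reflection makes the integrand of `J` a convolution integrand: at `z = t - y` this function
  -- is `|g(y - t)|²`.
  have hG : Integrable fun z => conj (g (-z)) * g (-z) := by
    refine (g.integrable.comp_neg).bdd_mul (c := Mg) ?_ (.of_forall fun y => ?_)
    · exact (Complex.continuous_conj.comp (g.continuous.comp continuous_neg)).aestronglyMeasurable
    · simpa using hMg (-y)
  have hswap : ∫ t, J t = ∫ y, (h y * conj (γ (y - x)) * wave ħ (-(ξ * y))) * N := by
    rw [hJ, integral_integral_swap]
    · refine integral_congr_ae (.of_forall fun y => ?_)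
      simp only
      rw [integral_const_mul, integral_sub_left_eq_self (fun z => conj (g z) * g z) volume y, hN,
        ← integral_complex_ofReal]
      congr 1
      refine integral_congr_ae (.of_forall fun z => ?_)
      simp only [← Complex.normSq_eq_conj_mul_self, Complex.normSq_eq_norm_sq]
    · refine (hA.convolution_integrand (ContinuousLinearMap.mul ℝ ℂ) hG).congr
        (.of_forall fun p => ?_)
      simp [Function.uncurry]
  have hfin : (N : ℂ) * stftFun ħ γ h x ξ = c * ∫ t, J t := by
    rw [hswap, integral_mul_const, stftFun_eq, oscInt_real]
    ring
  have hKx : Integrable fun t => K (t - x) := hK.comp_sub_right x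
  have hJi : ‖∫ t, J t‖ ≤ ‖c‖ * C * D ξ * ∫ t, K t := by
    rw [← integral_sub_right_eq_self K x, ← integral_const_mul]
    exact norm_integral_le_of_norm_le (hKx.const_mul _) (.of_forall hJb)
  have h5 : stftFun ħ γ h x ξ = (N : ℂ)⁻¹ * (c * ∫ t, J t) := by
    rw [← hfin, inv_mul_cancel_left₀ (by exact_mod_cast hNpos.ne')]
  rw [h5, norm_mul, norm_mul, norm_inv, Complex.norm_real, Real.norm_of_nonneg hNpos.le]
  calc _ ≤ N⁻¹ * (‖c‖ * (‖c‖ * C * D ξ * ∫ t, K t)) := by gcongr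
    _ = _ := by ring

/-- Functions in the Sjöstrand class are bounded, and their Gabor transforms with arbitrary windows are
dominated by integrable functions of the frequency. -/
theorem MemSjostrand.bounded_and_dominated {ħ : ℝ} (hħ : 0 < ħ) {h : ℝ → ℂ}
    (hm : MemSjostrand ħ h) :
    (∃ B, ∀ y, ‖h y‖ ≤ B) ∧ ∀ γ : 𝓢(ℝ, ℂ), STFTDominated ħ γ h := by
  obtain ⟨hc, u, hu, g, hg, hfin⟩ := hm
  simp only [sjostrandNorm, hu.stft_eq] at hfin
  obtain ⟨B, hB⟩ := exists_bound_of_sjostrandNorm_lt_top hħ hc (fun φ => (hu φ).1) hg hfin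
  exact ⟨⟨B, hB⟩, fun γ =>
    (STFTDominated.of_sjostrandNorm_lt_top hc hB hfin).change_window hħ hc hB hg γ⟩

/-! ### Ridge functions in several variables. -/

section Ridge

variable {E : Type*} [NormedAddCommGroup E] [InnerProductSpace ℝ E] [FiniteDimensional ℝ E]
  [MeasurableSpace E] [BorelSpace E]

theorem exists_schwartz_apply_zero_eq_one (E : Type*) [NormedAddCommGroup E]
    [InnerProductSpace ℝ E] [FiniteDimensional ℝ E] : ∃ φ : 𝓢(E, ℂ), φ 0 = 1 := by
  let b : ContDiffBump (0 : E) := ⟨1, 2, one_pos, one_lt_two⟩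
  have h1 : HasCompactSupport fun x => (b x : ℂ) :=
    b.hasCompactSupport.comp_left (g := fun t : ℝ => (t : ℂ)) (by simp)
  have h2 : ContDiff ℝ (⊤ : ℕ∞) fun x => (b x : ℂ) := Complex.ofRealCLM.contDiff.comp b.contDiff
  refine ⟨h1.toSchwartzMap h2, ?_⟩
  have : b (0 : E) = 1 := b.one_of_mem_closedBall (Metric.mem_closedBall_self zero_le_one)
  simp [this]

/-- Composing a function in the Sjöstrand class of the line with a linear form gives a function in the
Sjöstrand class. -/
theorem MemSjostrand.comp_inner {ħ : ℝ} (hħ : 0 < ħ) {h : ℝ → ℂ} (hm : MemSjostrand ħ h) (κ : E) :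
    MemSjostrand ħ fun x : E => h (inner ℝ κ x) := by
  obtain ⟨⟨B, hB⟩, hdom⟩ := hm.bounded_and_dominated hħ
  have hc := hm.1
  have hh := integrable_schwartz_mul hc hB
  have hcE : Continuous fun x : E => h (inner ℝ κ x) := hc.comp (by fun_prop)
  obtain ⟨u, hu⟩ := exists_represents_of_bounded hcE (fun x => hB _)
  obtain ⟨g, hg⟩ := exists_schwartz_apply_zero_eq_one ℝ
  obtain ⟨Φ, hΦ⟩ := exists_schwartz_apply_zero_eq_one E
  have hgκ : (fun x : E => g (inner ℝ κ x)).HasTemperateGrowth :=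
    g.hasTemperateGrowth.comp (Function.hasTemperateGrowth_inner_right κ)
  -- The factor `g(κ·x)` lets the one-dimensional inversion formula act on the profile, while `Φ`
  -- supplies decay in the remaining directions.
  set Ψ : 𝓢(E, ℂ) := SchwartzMap.smulLeftCLM ℂ (fun x : E => g (inner ℝ κ x)) Φ with hΨ
  have hΨe : ∀ x, Ψ x = g (inner ℝ κ x) * Φ x := fun x => by
    rw [hΨ, SchwartzMap.smulLeftCLM_apply_apply hgκ]; rfl
  refine ⟨hcE, u, hu, Ψ, fun h0 => ?_, ?_⟩
  · have := hΨe 0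
    simp [h0, hg, hΦ] at this
  obtain ⟨W, hW, hWb⟩ := hdom g
  set cE := planckConst ħ E
  set c := planckConst ħ ℝ
  set θ : E → ℝ := fun ξ => ‖oscInt ħ (fun y => conj (Φ y)) ξ‖ with hθ
  have hθi : Integrable θ := by
    have h1 : oscInt ħ (fun y => conj (Φ y)) =
        fun ξ => (𝓕 (conjSchwartz Φ)) ((2 * Real.pi * ħ)⁻¹ • ξ) := by
      ext ξ; rw [oscInt_eq_fourier]; rfl
    rw [hθ, h1]
    exact ((integrable_comp_smul_iff volume _ (by positivity)).2
      (𝓕 (conjSchwartz Φ)).integrable).norm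
  have hWθ : Integrable (fun p : ℝ × E => W p.1 * θ (p.2 - p.1 • κ)) := by
    have hmeas : AEStronglyMeasurable (fun p : ℝ × E => W p.1 * θ (p.2 - p.1 • κ))
        (volume.prod volume) := by
      refine hW.1.comp_fst.mul ?_
      refine Continuous.aestronglyMeasurable ?_
      have : Continuous θ := (continuous_oscInt ħ (conjSchwartz Φ).integrable).norm
      exact this.comp (by fun_prop)
    refine (integrable_prod_iff hmeas).2 ⟨.of_forall fun η => ?_, ?_⟩
    · exact (hθi.comp_sub_right (η • κ)).const_mul (W η)
    · simp only [norm_mul]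
      simp_rw [integral_const_mul]
      have : ∀ η : ℝ, (∫ y : E, ‖θ (y - η • κ)‖) = ∫ y : E, ‖θ y‖ := fun η =>
        integral_sub_right_eq_self (fun y => ‖θ y‖) (η • κ)
      simp_rw [this]
      exact hW.norm.mul_const _
  -- The frequencies of a ridge function lie on the line `ℝκ`. The window smears each frequency `ηκ`
  -- by the transform of `Φ`, whose modulus `θ` does not depend on the centre `x`.
  have hbound : ∀ x ξ : E, ‖stftFun ħ Ψ (fun x : E => h (inner ℝ κ x)) x ξ‖ ≤
      ‖cE‖ * (‖c‖ * ∫ η, W η * θ (ξ - η • κ)) := by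
    intro x ξ
    set t : ℝ := inner ℝ κ x with ht
    have hV : Integrable (stftFun ħ g h t) :=
      hW.mono' (continuous_stftFun ħ hh g t).aestronglyMeasurable (.of_forall (hWb t))
    have hb : Integrable fun y => conj (Φ (y - x)) * wave ħ (-(inner ℝ ξ y : ℝ)) := by
      refine (conjSchwartz (SchwartzMap.compSubConstCLM ℂ x Φ)).integrable.mul_bdd (c := 1) ?_
        (.of_forall fun y => by simp)
      exact (by fun_prop : Continuous fun y => wave ħ (-(inner ℝ ξ y : ℝ))).aestronglyMeasurable
    have h1 : oscInt ħ (fun y => h (inner ℝ κ y) * conj (Ψ (y - x))) ξ =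
        c * ∫ y, (conj (Φ (y - x)) * wave ħ (-(inner ℝ ξ y : ℝ))) *
          ∫ η, stftFun ħ g h t η * wave ħ (η * inner ℝ κ y) := by
      rw [← integral_const_mul, oscInt]
      refine integral_congr_ae (.of_forall fun y => ?_)
      have := mul_conj_eq_integral_stftFun hħ hc hh g t hV (inner ℝ κ y)
      rw [ht, ← inner_sub_right] at this
      simp only [hΨe, map_mul]
      linear_combination (conj (Φ (y - x)) * wave ħ (-(inner ℝ ξ y : ℝ))) * this
    have h2 := integral_mul_integral_swap hb hV (q := fun y η => wave ħ (η * inner ℝ κ y)) (C := 1)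
      (by fun_prop : Continuous (Function.uncurry fun (y : E) (η : ℝ) =>
        wave ħ (η * inner ℝ κ y))).aestronglyMeasurable (fun y η => by simp)
    have h3 : ∀ η : ℝ, ‖∫ y, conj (Φ (y - x)) * wave ħ (-(inner ℝ ξ y : ℝ)) *
        wave ħ (η * inner ℝ κ y)‖ = θ (ξ - η • κ) := by
      intro η
      have := oscInt_comp_sub ħ (fun y => conj (Φ y)) x (ξ - η • κ)
      rw [hθ]
      simp only
      rw [← one_mul ‖oscInt ħ (fun y => conj (Φ y)) (ξ - η • κ)‖,
        ← norm_wave ħ (-(inner ℝ (ξ - η • κ) x : ℝ)), ← norm_mul, ← this, oscInt]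
      congr 1
      refine integral_congr_ae (.of_forall fun y => ?_)
      simp only [mul_assoc, ← wave_add, inner_sub_left, real_inner_smul_left]
      congr 2
      ring
    have hint : Integrable fun η => W η * θ (ξ - η • κ) := by
      obtain ⟨M, hM⟩ : ∃ M, ∀ ξ, θ ξ ≤ M := ⟨_, fun ξ => norm_oscInt_le ħ _ ξ⟩
      refine hW.mul_bdd (c := M) ?_ (.of_forall fun η => ?_)
      · have : Continuous θ := (continuous_oscInt ħ (conjSchwartz Φ).integrable).norm
        exact (this.comp (by fun_prop)).aestronglyMeasurable
      · rw [Real.norm_of_nonneg (norm_nonneg _)]; exact hM _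
    rw [stftFun_eq, norm_mul, h1, h2, norm_mul]
    gcongr
    refine norm_integral_le_of_norm_le hint (.of_forall fun η => ?_)
    rw [norm_mul, h3]
    gcongr
    exact hWb t η
  have hfinal : Integrable fun ξ : E => ‖cE‖ * (‖c‖ * ∫ η, W η * θ (ξ - η • κ)) :=
    (hWθ.integral_prod_right.const_mul _).const_mul _
  simp only [sjostrandNorm, hu.stft_eq]
  refine lt_of_le_of_lt (lintegral_mono fun ξ => iSup_le fun x => ?_) hfinal.2
  refine (enorm_le_iff_norm_le).2 ((hbound x ξ).trans (le_abs_self _))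

end Ridge

/-! ### The Gabor transform of a chirp -/

/-- The integral `∫ g(ζ-η) e^{(i/ħ)(ζ s - lam² ζ²/2)} dζ`, which is up to a constant the conjugate of
the Gabor transform of the chirp `F₊ ∘ lam` at `(η,s)`. -/
def chirpInt (ħ : ℝ) (g : 𝓢(ℝ, ℂ)) (lam η s : ℝ) : ℂ :=
  ∫ ζ, g (ζ - η) * wave ħ (ζ * s - lam ^ 2 * ζ ^ 2 / 2)

theorem fresnelFun_eq_wave {E : Type*} [NormedAddCommGroup E] [InnerProductSpace ℝ E] (ħ : ℝ)
    (x : E) : fresnelFun ħ x = fresnelConst ħ E * wave ħ (‖x‖ ^ 2 / 2) := by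
  rw [fresnelFun, wave]
  congr 2
  push_cast
  ring

theorem conj_stftFun_chirp (ħ : ℝ) (g : 𝓢(ℝ, ℂ)) (lam η s : ℝ) :
    conj (stftFun ħ g (fun y : ℝ => fresnelFun ħ (lam * y)) η s) =
      conj (fresnelConst ħ ℝ) * planckConst ħ ℝ * chirpInt ħ g lam η s := by
  have h1 : conj (planckConst ħ ℝ) = planckConst ħ ℝ := by
    simp only [planckConst, Complex.conj_ofReal]
  rw [stftFun_eq, oscInt_real, map_mul, ← integral_conj, h1, chirpInt, mul_comm (conj _),
    mul_assoc, ← integral_const_mul (μ := volume) (conj (fresnelConst ħ ℝ))]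
  refine congrArg _ (integral_congr_ae (.of_forall fun y => ?_))
  simp only [map_mul, fresnelFun_eq_wave, conj_wave, Complex.conj_conj, neg_neg, Real.norm_eq_abs,
    sq_abs]
  rw [show y * s - lam ^ 2 * y ^ 2 / 2 = -((lam * y) ^ 2 / 2) + s * y by ring, wave_add]
  ring

/-- Substituting `ζ = y + η`, the cross term of the quadratic phase is a frequency shift by `lam²
η`; this is why the transform concentrates on a line. -/
theorem chirpInt_eq_oscInt (ħ : ℝ) (g : 𝓢(ℝ, ℂ)) (lam η s : ℝ) :
    chirpInt ħ g lam η s = wave ħ (η * s - lam ^ 2 * η ^ 2 / 2) *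
      oscInt ħ (fun y => wave ħ (-(lam ^ 2 / 2) * y ^ 2) * g y) (lam ^ 2 * η - s) := by
  rw [chirpInt, ← integral_add_right_eq_self _ η, oscInt_real, ← integral_const_mul]
  refine integral_congr_ae (.of_forall fun y => ?_)
  simp only [add_sub_cancel_right]
  rw [show (y + η) * s - lam ^ 2 * (y + η) ^ 2 / 2 = (η * s - lam ^ 2 * η ^ 2 / 2) +
    (-(lam ^ 2 / 2) * y ^ 2 + -((lam ^ 2 * η - s) * y)) by ring, wave_add, wave_add]
  ring

theorem exists_chirpInt_decay {ħ : ℝ} (hħ : 0 < ħ) (g : 𝓢(ℝ, ℂ)) (M : ℝ) :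
    ∃ C : ℝ, 0 ≤ C ∧ ∀ lam : ℝ, |lam| ≤ M → ∀ η s : ℝ,
      ‖chirpInt ħ g lam η s‖ ≤ C * (1 + (s - lam ^ 2 * η) ^ 2)⁻¹ := by
  obtain ⟨C, hC0, hC⟩ := exists_oscInt_decay hħ g
  refine ⟨C * (1 + M ^ 2 / ħ + (M ^ 2 / ħ) ^ 2), by positivity, fun lam hlam η s => ?_⟩
  rw [chirpInt_eq_oscInt, norm_mul, norm_wave, one_mul]
  have hM2 : lam ^ 2 ≤ M ^ 2 := by rw [← sq_abs]; gcongr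
  set b := lam ^ 2 / ħ with hb
  have hb0 : 0 ≤ b := by positivity
  have hbM : b ≤ M ^ 2 / ħ := by rw [hb]; gcongr
  set a : ℝ → ℂ := fun y => wave ħ (-(lam ^ 2 / 2) * y ^ 2) with ha
  have hna : ∀ y, ‖a y‖ = 1 := fun y => norm_wave _ _
  have hħ' : (ħ : ℂ) ≠ 0 := by exact_mod_cast hħ.ne'
  have hda : ∀ y, HasDerivAt a (-(Complex.I * b) * y * a y) y := by
    intro y
    have h1 : HasDerivAt (fun y : ℝ => -(lam ^ 2 / 2) * y ^ 2) (-(lam ^ 2 / 2) * (2 * y)) y := by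
      simpa using (hasDerivAt_pow 2 y).const_mul (-(lam ^ 2 / 2))
    refine ((hasDerivAt_wave ħ _).scomp y h1).congr_deriv ?_
    rw [Complex.real_smul, hb]
    push_cast
    have e : a y = wave ħ (-(lam ^ 2 * y ^ 2 / 2)) := by simp only [ha]; congr 1; ring
    field_simp
    rw [e]
  have d1 : deriv a = fun y => -(Complex.I * b) * y * a y := funext fun y => (hda y).deriv
  have d2 : deriv (deriv a) = fun y : ℝ => -(Complex.I * b) * a y +
      (-(Complex.I * b) * y) * (-(Complex.I * b) * y * a y) := by
    rw [d1]
    ext y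
    have h1 : HasDerivAt (fun y : ℝ => -(Complex.I * b) * (y : ℂ)) (-(Complex.I * b)) y := by
      simpa using (Complex.ofRealCLM.hasDerivAt (x := y)).const_mul (-(Complex.I * b))
    exact (h1.mul (hda y)).deriv
  have hgrow : a.HasTemperateGrowth :=
    (hasTemperateGrowth_wave ħ).comp
      ((Function.HasTemperateGrowth.const _).mul (Function.HasTemperateGrowth.id'.pow 2))
  have nb : ‖-(Complex.I * (b : ℂ))‖ = b := by simp [abs_of_nonneg hb0]
  have hb2 : b ^ 2 ≤ (M ^ 2 / ħ) ^ 2 := by gcongr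
  have hM0 : 0 ≤ M ^ 2 / ħ := by positivity
  -- This growth constant covers `|a| = 1`, `|a'| = b|y|` and `|a''| ≤ b + b² y²` simultaneously,
  -- for all `b ≤ M²/ħ`.
  have key := hC a hgrow (1 + M ^ 2 / ħ + (M ^ 2 / ħ) ^ 2) (fun y => ?_) (fun y => ?_) (fun y => ?_)
    (lam ^ 2 * η - s)
  · refine key.trans (le_of_eq ?_)
    congr 3
    ring
  · rw [hna]; nlinarith [sq_nonneg y, mul_nonneg hM0 (sq_nonneg y), sq_nonneg (M ^ 2 / ħ),
      mul_nonneg (sq_nonneg (M ^ 2 / ħ)) (sq_nonneg y)]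
  · rw [d1]
    simp only [norm_mul, nb, hna, mul_one, Complex.norm_real, Real.norm_eq_abs]
    have h1 : |y| ≤ 1 + y ^ 2 := by nlinarith [sq_abs y, sq_nonneg (|y| - 1), abs_nonneg y]
    calc b * |y| ≤ (M ^ 2 / ħ) * (1 + y ^ 2) := by gcongr
      _ ≤ _ := by
        gcongr
        nlinarith [sq_nonneg (M ^ 2 / ħ)]
  · rw [d2]
    refine (norm_add_le _ _).trans ?_
    simp only [norm_mul, nb, hna, mul_one, Complex.norm_real, Real.norm_eq_abs]
    have h1 : b * |y| * (b * |y|) = b ^ 2 * y ^ 2 := by rw [← sq_abs y]; ring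
    rw [h1]
    calc b + b ^ 2 * y ^ 2 ≤ M ^ 2 / ħ + (M ^ 2 / ħ) ^ 2 * y ^ 2 := by gcongr
      _ ≤ _ := by nlinarith [sq_nonneg y, mul_nonneg hM0 (sq_nonneg y), sq_nonneg (M ^ 2 / ħ)]

theorem continuous_chirpInt (ħ : ℝ) (g : 𝓢(ℝ, ℂ)) (lam : ℝ) :
    Continuous fun z : ℝ × ℝ => chirpInt ħ g lam z.1 z.2 := by
  have h1 : Integrable fun y => wave ħ (-(lam ^ 2 / 2) * y ^ 2) * g y := by
    refine g.integrable.bdd_mul (c := 1) ?_ (.of_forall fun y => by simp)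
    exact (by fun_prop : Continuous fun y => wave ħ (-(lam ^ 2 / 2) * y ^ 2)).aestronglyMeasurable
  simp only [chirpInt_eq_oscInt]
  exact (by fun_prop : Continuous fun z : ℝ × ℝ => wave ħ (z.1 * z.2 - lam ^ 2 * z.1 ^ 2 / 2)).mul
    ((continuous_oscInt ħ h1).comp (by fun_prop))

theorem continuous_chirpInt_parameter (ħ : ℝ) (g : 𝓢(ℝ, ℂ)) (η s : ℝ) :
    Continuous fun lam : ℝ => chirpInt ħ g lam η s := by
  unfold chirpInt
  have hg : Continuous fun ζ => g (ζ - η) := g.continuous.comp (by fun_prop)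
  refine continuous_of_dominated (bound := fun ζ => ‖g (ζ - η)‖) (fun lam => ?_) (fun lam => ?_)
    (g.integrable.comp_sub_right η).norm ?_
  · exact (hg.mul (by fun_prop)).aestronglyMeasurable
  · exact .of_forall fun ζ => by simp
  · exact .of_forall fun ζ => by fun_prop

/-! ### The functionals on `L¹_x(L^∞_ξ)` -/

/-- For a measurable representative `G`, the essential supremum of a slice is at most `c` exactly
when the slice of `{c < ‖G‖}` is null, and the measure of a slice is a measurable function of `x`.
-/
theorem aemeasurable_eLpNorm_slice {H : ℝ × ℝ → ℂ} (hH : AEStronglyMeasurable H) :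
    AEMeasurable fun x : ℝ => eLpNorm (fun ξ => H (x, ξ)) ∞ := by
  obtain ⟨G, hG, hHG⟩ := hH
  refine ⟨fun x => eLpNorm (fun ξ => G (x, ξ)) ∞, measurable_of_Iic fun c => ?_, ?_⟩
  · have h1 : (fun x : ℝ => eLpNorm (fun ξ => G (x, ξ)) ∞) ⁻¹' Set.Iic c =
        {x : ℝ | (volume : Measure ℝ) (Prod.mk x ⁻¹' {z : ℝ × ℝ | c < ‖G z‖ₑ}) = 0} := by
      ext x
      simp only [eLpNorm_exponent_top, eLpNormEssSup, Set.mem_preimage, Set.mem_Iic,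
        Set.mem_ofPred_eq]
      constructor
      · intro h
        have h2 : ∀ᵐ ξ : ℝ, ‖G (x, ξ)‖ₑ ≤ c :=
          (ENNReal.ae_le_essSup fun ξ : ℝ => ‖G (x, ξ)‖ₑ).mono fun ξ hξ => hξ.trans h
        rw [ae_iff] at h2
        simpa using h2
      · intro h
        have h2 : (fun ξ : ℝ => ‖G (x, ξ)‖ₑ) ≤ᵐ[volume] fun _ => c := by
          rw [EventuallyLE, ae_iff]
          simpa using h
        exact essSup_le_of_ae_le c h2
    rw [h1]
    exact (measurable_measure_prodMk_left (measurableSet_lt measurable_const hG.enorm))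
      (measurableSet_singleton 0)
  · filter_upwards [Measure.ae_ae_eq_curry_of_prod (μ := (volume : Measure ℝ))
      (ν := (volume : Measure ℝ)) hHG] with x hx
    exact eLpNorm_congr_ae hx

/-- The constant relating `chirpInt` to the Gabor transform of the chirp. -/
def chirpConst (ħ : ℝ) : ℂ := conj (fresnelConst ħ ℝ) * planckConst ħ ℝ

theorem phaseIntegrand_eq (ħ : ℝ) (g : 𝓢(ℝ, ℂ)) (lam : ℝ) (H : ℝ × ℝ → ℂ) (z : ℝ × ℝ) :
    phaseIntegrand ħ g lam H z = H z * (chirpConst ħ * chirpInt ħ g lam z.1 z.2) := by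
  rw [phaseIntegrand, conj_stftFun_chirp, chirpConst]

theorem aestronglyMeasurable_phaseIntegrand (ħ : ℝ) (g : 𝓢(ℝ, ℂ)) (lam : ℝ) {H : ℝ × ℝ → ℂ}
    (hH : AEStronglyMeasurable H) : AEStronglyMeasurable (phaseIntegrand ħ g lam H) := by
  have : phaseIntegrand ħ g lam H = fun z => H z * (chirpConst ħ * chirpInt ħ g lam z.1 z.2) :=
    funext fun z => phaseIntegrand_eq ħ g lam H z
  rw [this]
  exact hH.mul (continuous_const.mul (continuous_chirpInt ħ g lam)).aestronglyMeasurable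

/-- The kernel is a translate of `(1 + ξ²)⁻¹`, so its integral `π` depends neither on `x` nor on
`lam`. -/
theorem lintegral_phaseIntegrand_slice_le {ħ : ℝ} {g : 𝓢(ℝ, ℂ)} {lam C : ℝ} (hC0 : 0 ≤ C)
    (hC : ∀ η s : ℝ, ‖chirpInt ħ g lam η s‖ ≤ C * (1 + (s - lam ^ 2 * η) ^ 2)⁻¹)
    (H : ℝ × ℝ → ℂ) (x : ℝ) :
    ∫⁻ ξ, ‖phaseIntegrand ħ g lam H (x, ξ)‖ₑ ≤
      ENNReal.ofReal (‖chirpConst ħ‖ * C * Real.pi) * eLpNorm (fun ξ => H (x, ξ)) ∞ := by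
  have h1 : ∀ᵐ ξ, ‖phaseIntegrand ħ g lam H (x, ξ)‖ₑ ≤ eLpNorm (fun ξ => H (x, ξ)) ∞ *
      ENNReal.ofReal (‖chirpConst ħ‖ * C * (1 + (ξ - lam ^ 2 * x) ^ 2)⁻¹) := by
    filter_upwards [ENNReal.ae_le_essSup fun ξ : ℝ => ‖H (x, ξ)‖ₑ] with ξ hξ
    rw [phaseIntegrand_eq, enorm_mul]
    refine mul_le_mul' hξ ?_
    rw [← ofReal_norm]
    refine ENNReal.ofReal_le_ofReal ?_
    rw [norm_mul, mul_assoc]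
    gcongr
    exact hC x ξ
  have hi : Integrable fun ξ : ℝ => ‖chirpConst ħ‖ * C * (1 + (ξ - lam ^ 2 * x) ^ 2)⁻¹ :=
    (integrable_inv_one_add_sq.comp_sub_right (lam ^ 2 * x)).const_mul _
  refine (lintegral_mono_ae h1).trans (le_of_eq ?_)
  rw [lintegral_const_mul _ (by fun_prop), mul_comm, ← ofReal_integral_eq_lintegral_ofReal hi
    (.of_forall fun ξ => by positivity), integral_const_mul,
    integral_sub_right_eq_self (fun ξ : ℝ => (1 + ξ ^ 2)⁻¹) (lam ^ 2 * x),
    integral_univ_inv_one_add_sq]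

theorem lintegral_phaseIntegrand_le {ħ : ℝ} {g : 𝓢(ℝ, ℂ)} {lam C : ℝ} (hC0 : 0 ≤ C)
    (hC : ∀ η s : ℝ, ‖chirpInt ħ g lam η s‖ ≤ C * (1 + (s - lam ^ 2 * η) ^ 2)⁻¹)
    {H : ℝ × ℝ → ℂ} (hH : AEStronglyMeasurable H) :
    ∫⁻ z, ‖phaseIntegrand ħ g lam H z‖ₑ ≤
      ENNReal.ofReal (‖chirpConst ħ‖ * C * Real.pi) * mixedNorm H := by
  rw [Measure.volume_eq_prod, lintegral_prod _
    (aestronglyMeasurable_phaseIntegrand ħ g lam hH).enorm, mixedNorm,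
    ← lintegral_const_mul' _ _ ENNReal.ofReal_ne_top]
  exact lintegral_mono fun x => lintegral_phaseIntegrand_slice_le hC0 hC H x

theorem integrable_phaseIntegrand {ħ : ℝ} (hħ : 0 < ħ) (g : 𝓢(ℝ, ℂ)) (lam : ℝ) {H : ℝ × ℝ → ℂ}
    (hH : H ∈ mixedL1Linf) : Integrable (phaseIntegrand ħ g lam H) := by
  obtain ⟨C, hC0, hC⟩ := exists_chirpInt_decay hħ g |lam|
  exact ⟨aestronglyMeasurable_phaseIntegrand ħ g lam hH.1,
    (lintegral_phaseIntegrand_le hC0 (hC lam le_rfl) hH.1).trans_lt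
      (ENNReal.mul_lt_top ENNReal.ofReal_lt_top hH.2)⟩

theorem isLinearMap_phaseFunctional {ħ : ℝ} (hħ : 0 < ħ) (g : 𝓢(ℝ, ℂ)) (lam : ℝ) :
    IsLinearMap ℂ (fun H : mixedL1Linf => phaseFunctional ħ g lam (H : ℝ × ℝ → ℂ)) where
  map_add H K := by
    rw [phaseFunctional, phaseFunctional, phaseFunctional,
      ← integral_add (integrable_phaseIntegrand hħ g lam H.2)
        (integrable_phaseIntegrand hħ g lam K.2)]
    refine integral_congr_ae (.of_forall fun z => ?_)
    simp [phaseIntegrand, add_mul]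
  map_smul a H := by
    rw [phaseFunctional, phaseFunctional, smul_eq_mul, ← integral_const_mul]
    refine integral_congr_ae (.of_forall fun z => ?_)
    simp [phaseIntegrand, mul_assoc]

theorem exists_norm_phaseFunctional_le {ħ : ℝ} (hħ : 0 < ħ) (g : 𝓢(ℝ, ℂ)) (M : ℝ) :
    ∃ C : ℝ, ∀ lam : ℝ, |lam| ≤ M → ∀ H ∈ mixedL1Linf,
      ‖phaseFunctional ħ g lam H‖ ≤ C * (mixedNorm H).toReal := by
  obtain ⟨C, hC0, hC⟩ := exists_chirpInt_decay hħ g M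
  refine ⟨‖chirpConst ħ‖ * C * Real.pi, fun lam hlam H hH => ?_⟩
  have hpos : 0 ≤ ‖chirpConst ħ‖ * C * Real.pi := by positivity
  rw [← ENNReal.toReal_ofReal hpos, ← ENNReal.toReal_mul, ← toReal_enorm]
  exact ENNReal.toReal_mono (ENNReal.mul_lt_top ENNReal.ofReal_lt_top hH.2).ne
    ((enorm_integral_le_lintegral_enorm _).trans (lintegral_phaseIntegrand_le hC0 (hC lam hlam) hH.1))

/-- The kernel is centred at `lam n ^ 2 * x`, which moves with `n` by an amount growing in `x`.
Convergence is therefore taken in two stages: for fixed `x`, Peetre's inequality gives a majorant in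
`ξ` whose constant may depend on `x`; the slice bound, uniform in `lam n`, then dominates the outer
integral. -/
theorem tendsto_phaseFunctional {ħ : ℝ} (hħ : 0 < ħ) (g : 𝓢(ℝ, ℂ)) {lam : ℕ → ℝ} {l M : ℝ}
    (hM : ∀ n, |lam n| ≤ M) (hl : Tendsto lam atTop (𝓝 l)) {H : ℝ × ℝ → ℂ}
    (hH : H ∈ mixedL1Linf) :
    Tendsto (fun n => phaseFunctional ħ g (lam n) H) atTop (𝓝 (phaseFunctional ħ g l H)) := by
  obtain ⟨C, hC0, hC⟩ := exists_chirpInt_decay hħ g M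
  have hfub : ∀ lam, phaseFunctional ħ g lam H = ∫ x, ∫ ξ, phaseIntegrand ħ g lam H (x, ξ) :=
    fun lam => integral_prod _ (integrable_phaseIntegrand hħ g lam hH)
  simp only [hfub]
  have hmeas := aemeasurable_eLpNorm_slice hH.1
  have hfin : ∀ᵐ x, eLpNorm (fun ξ => H (x, ξ)) ∞ < ∞ := ae_lt_top' hmeas hH.2.ne
  refine tendsto_integral_of_dominated_convergence
    (fun x => (ENNReal.ofReal (‖chirpConst ħ‖ * C * Real.pi) *
      eLpNorm (fun ξ => H (x, ξ)) ∞).toReal) (fun n => ?_) ?_ (fun n => ?_) ?_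
  · exact (integrable_phaseIntegrand hħ g (lam n) hH).integral_prod_left.1
  · refine integrable_toReal_of_lintegral_ne_top (hmeas.const_mul _) ?_
    rw [lintegral_const_mul' _ _ ENNReal.ofReal_ne_top]
    exact (ENNReal.mul_lt_top ENNReal.ofReal_lt_top hH.2).ne
  · filter_upwards [hfin] with x hx
    rw [← toReal_enorm]
    exact ENNReal.toReal_mono (ENNReal.mul_lt_top ENNReal.ofReal_lt_top hx).ne
      ((enorm_integral_le_lintegral_enorm _).trans
        (lintegral_phaseIntegrand_slice_le hC0 (hC _ (hM n)) H x))
  · filter_upwards [hfin, hH.1.prodMk_left] with x hx hmx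
    refine tendsto_integral_of_dominated_convergence
      (fun ξ => (eLpNorm (fun ξ => H (x, ξ)) ∞).toReal *
        (‖chirpConst ħ‖ * (C * (2 * (1 + (M ^ 2 * x) ^ 2) * (1 + ξ ^ 2)⁻¹)))) (fun n => ?_) ?_
      (fun n => ?_) ?_
    · simp only [phaseIntegrand_eq]
      exact hmx.mul (continuous_const.mul ((continuous_chirpInt ħ g (lam n)).comp
        (by fun_prop : Continuous fun ξ : ℝ => (x, ξ)))).aestronglyMeasurable
    · exact (((integrable_inv_one_add_sq.const_mul _).const_mul _).const_mul _).const_mul _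
    · filter_upwards [ENNReal.ae_le_essSup fun ξ : ℝ => ‖H (x, ξ)‖ₑ] with ξ hξ
      rw [phaseIntegrand_eq, norm_mul, norm_mul]
      gcongr
      · rw [← toReal_enorm]
        exact ENNReal.toReal_mono hx.ne hξ
      · refine (hC _ (hM n) x ξ).trans ?_
        gcongr
        have h1 := inv_one_add_sq_add_le ξ (-(lam n ^ 2 * x))
        rw [← sub_eq_add_neg, neg_sq] at h1
        refine h1.trans ?_
        have h2 : lam n ^ 2 ≤ M ^ 2 := by rw [← sq_abs]; gcongr; exact hM n
        rw [mul_pow, mul_pow]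
        gcongr
    · refine .of_forall fun ξ => ?_
      simp only [phaseIntegrand_eq]
      exact (((continuous_chirpInt_parameter ħ g x ξ).tendsto l).comp hl).const_mul _ |>.const_mul _

/-! ### Projections of square summable sequences -/

theorem norm_sq_proj (n : ℕ) (k : L2seq) : ‖proj n k‖ ^ 2 = ∑ j ∈ Finset.range n, k j ^ 2 := by
  rw [EuclideanSpace.norm_sq_eq, Finset.sum_range]
  simp [proj]

theorem hasSum_sq (k : L2seq) : HasSum (fun j => k j ^ 2) (‖k‖ ^ 2) := by
  have h := lp.hasSum_norm (p := 2) (by norm_num) k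
  simpa using h

theorem norm_proj_le (n : ℕ) (k : L2seq) : ‖proj n k‖ ≤ ‖k‖ := by
  refine (sq_le_sq₀ (norm_nonneg _) (norm_nonneg _)).1 ?_
  rw [norm_sq_proj]
  exact sum_le_hasSum _ (fun j _ => sq_nonneg _) (hasSum_sq k)

theorem tendsto_norm_proj (k : L2seq) : Tendsto (fun n => ‖proj n k‖) atTop (𝓝 ‖k‖) := by
  have h := (hasSum_sq k).tendsto_sum_nat
  simp only [← norm_sq_proj] at h
  have h2 := (Real.continuous_sqrt.tendsto _).comp h
  simpa [Function.comp_def, Real.sqrt_sq] using h2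

/-- Finitely supported sequences lie in `ℓ²`, so the value `0` off `ℓ²` never enters. -/
theorem restrictFin_ridge (h : ℝ → ℂ) (k : L2seq) (n : ℕ) :
    restrictFin (ridge h k) n = fun x => h (inner ℝ (proj n k) x) := by
  ext x
  have hz : ∀ j ∉ Finset.range n, (if hj : j < n then x ⟨j, hj⟩ else 0) = 0 := fun j hj => by
    rw [dif_neg (by simpa using hj)]
  have hm : Memℓp (fun j => if hj : j < n then x ⟨j, hj⟩ else 0) 2 := by
    refine (memℓp_gen_iff (by norm_num)).2 (summable_of_ne_finset_zero (s := Finset.range n) ?_)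
    intro j hj
    simp [hz j hj]
  rw [restrictFin, ridge, dif_pos hm, lp.inner_eq_tsum, tsum_eq_sum (s := Finset.range n),
    Finset.sum_range, PiLp.inner_apply]
  · congr 1
    refine Finset.sum_congr rfl fun j _ => ?_
    simp [proj]
  · intro j hj
    simp [hz j hj]

/-! ### Fresnel integrals of plane waves -/

section Euclidean

variable {E : Type*} [NormedAddCommGroup E] [InnerProductSpace ℝ E]

theorem norm_fresnelFun (ħ : ℝ) (x : E) : ‖fresnelFun ħ x‖ = ‖fresnelConst ħ E‖ := by
  rw [fresnelFun_eq_wave, norm_mul, norm_wave, mul_one]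

theorem continuous_fresnelFun (ħ : ℝ) : Continuous (fresnelFun ħ : E → ℂ) := by
  have : (fresnelFun ħ : E → ℂ) = fun x => fresnelConst ħ E * wave ħ (‖x‖ ^ 2 / 2) :=
    funext fun x => fresnelFun_eq_wave ħ x
  rw [this]
  fun_prop

theorem fresnelConst_mul_cpow {ħ : ℝ} (hħ : 0 < ħ) :
    fresnelConst ħ E * (2 * Real.pi * Complex.I * ħ) ^ (finrank ℝ E / 2 : ℂ) = 1 := by
  have h1 : (2 * Real.pi * Complex.I * ħ : ℂ) ≠ 0 := by
    have h2 : (ħ : ℂ) ≠ 0 := by exact_mod_cast hħ.ne'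
    have h3 : (Real.pi : ℂ) ≠ 0 := by exact_mod_cast Real.pi_ne_zero
    simp [h2, h3]
  rw [fresnelConst, ← Complex.cpow_add _ _ h1]
  rw [show (-(finrank ℝ E : ℂ) / 2 + finrank ℝ E / 2) = 0 by ring, Complex.cpow_zero]

variable [FiniteDimensional ℝ E] [MeasurableSpace E] [BorelSpace E]

theorem fourier_smul_eq_integral_wave {ħ : ℝ} (hħ : 0 < ħ) (θ : 𝓢(E, ℂ)) (ε : ℝ) (x : E) :
    (𝓕 θ) (ε • x) = ∫ w, θ w * wave ħ (-(inner ℝ ((2 * Real.pi * ħ * ε) • w) x : ℝ)) := by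
  rw [SchwartzMap.fourier_coe, Real.fourier_eq']
  refine integral_congr_ae (.of_forall fun w => ?_)
  simp only [smul_eq_mul, wave_eq, inner_smul_right, real_inner_smul_left]
  rw [mul_comm]
  congr 3
  field_simp

/-- Writing out `𝓕 θ` and exchanging integrals leaves a Gaussian integral with linear term for each
`w`; the condition on `b.re` makes everything absolutely convergent. -/
theorem integral_gaussian_mul_fourier {ħ : ℝ} (hħ : 0 < ħ) (θ : 𝓢(E, ℂ)) (ε : ℝ) (v : E) {b : ℂ}
    (hb : 0 < b.re) :
    ∫ x, Complex.exp (-b * ‖x‖ ^ 2) * wave ħ (inner ℝ v x) * (𝓕 θ) (ε • x) =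
      (Real.pi / b) ^ (finrank ℝ E / 2 : ℂ) * ∫ w, θ w * Complex.exp
        ((Complex.I / ħ) ^ 2 * ‖v - (2 * Real.pi * ħ * ε) • w‖ ^ 2 / (4 * b)) := by
  have hA : Integrable fun x : E => Complex.exp (-b * ‖x‖ ^ 2) * wave ħ (inner ℝ v x) := by
    have := GaussianFourier.integrable_cexp_neg_mul_sq_norm_add hb (Complex.I / ħ) v
    refine this.congr (.of_forall fun x => ?_)
    simp only [wave, ← Complex.exp_add]
  simp only [fourier_smul_eq_integral_wave hħ]
  rw [integral_mul_integral_swap hA θ.integrable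
    (q := fun x w => wave ħ (-(inner ℝ ((2 * Real.pi * ħ * ε) • w) x : ℝ))) (C := 1)
    (by fun_prop : Continuous (Function.uncurry fun (x w : E) =>
      wave ħ (-(inner ℝ ((2 * Real.pi * ħ * ε) • w) x : ℝ)))).aestronglyMeasurable
    (fun x w => by simp), ← integral_const_mul]
  refine integral_congr_ae (.of_forall fun w => ?_)
  simp only
  have h := GaussianFourier.integral_cexp_neg_mul_sq_norm_add hb (Complex.I / ħ)
    (v - (2 * Real.pi * ħ * ε) • w)
  rw [mul_left_comm, ← h]
  congr 1
  refine integral_congr_ae (.of_forall fun x => ?_)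
  simp only [wave, ← Complex.exp_add, inner_sub_left]
  congr 1
  push_cast
  ring

theorem integrable_fourier_smul (θ : 𝓢(E, ℂ)) {ε : ℝ} (hε : ε ≠ 0) :
    Integrable fun x : E => (𝓕 θ) (ε • x) :=
  (integrable_comp_smul_iff volume _ hε).2 (𝓕 θ).integrable

/-- The regularised Fresnel integral of a plane wave. -/
theorem integral_fresnelFun_mul_wave {ħ : ℝ} (hħ : 0 < ħ) (θ : 𝓢(E, ℂ)) {ε : ℝ} (hε : ε ≠ 0)
    (v : E) :
    ∫ x, fresnelFun ħ x * (𝓕 θ) (ε • x) * wave ħ (inner ℝ v x) =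
      ∫ w, θ w * wave ħ (-(‖v - (2 * Real.pi * ħ * ε) • w‖ ^ 2 / 2)) := by
  have hħ' : (ħ : ℂ) ≠ 0 := by exact_mod_cast hħ.ne'
  have hπ : (Real.pi : ℂ) ≠ 0 := by exact_mod_cast Real.pi_ne_zero
  -- With this `b0`, `e^{-b0 |x|²}` is the Fresnel phase. It lies on the boundary of the half-plane
  -- where the Gaussian formula holds, so it is approached through `δ + b0` as `δ ↓ 0`.
  set b0 : ℂ := -Complex.I / (2 * ħ) with hb0
  have hb0ne : b0 ≠ 0 := by simp [hb0, hħ']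
  set b : ℝ → ℂ := fun δ => δ + b0 with hb
  have hbre : ∀ δ, (b δ).re = δ := by
    intro δ
    have : b0 = ((-(1 / (2 * ħ)) : ℝ) : ℂ) * Complex.I := by rw [hb0]; push_cast; ring
    rw [hb, this]
    simp
  have hbt : Tendsto b (𝓝[>] 0) (𝓝 b0) := by
    have : Continuous b := by fun_prop
    have h := this.tendsto 0
    simp only [hb, Complex.ofReal_zero, zero_add] at h
    exact h.mono_left nhdsWithin_le_nhds
  have hev : ∀ᶠ δ in 𝓝[>] (0 : ℝ), 0 < (b δ).re := by
    filter_upwards [self_mem_nhdsWithin] with δ hδ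
    rw [hbre]; exact hδ
  have hL : Tendsto (fun δ => ∫ x, Complex.exp (-b δ * ‖x‖ ^ 2) * wave ħ (inner ℝ v x) *
      (𝓕 θ) (ε • x)) (𝓝[>] 0)
      (𝓝 (∫ x, Complex.exp (-b0 * ‖x‖ ^ 2) * wave ħ (inner ℝ v x) * (𝓕 θ) (ε • x))) := by
    refine tendsto_integral_filter_of_dominated_convergence (fun x => ‖(𝓕 θ) (ε • x)‖) ?_ ?_
      (integrable_fourier_smul θ hε).norm ?_
    · refine .of_forall fun δ => Continuous.aestronglyMeasurable ?_
      have := (𝓕 θ).continuous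
      fun_prop
    · filter_upwards [hev] with δ hδ
      refine .of_forall fun x => ?_
      rw [norm_mul, norm_mul, norm_wave, mul_one]
      refine mul_le_of_le_one_left (norm_nonneg _) ?_
      rw [Complex.norm_exp, Real.exp_le_one_iff]
      have : (-b δ * (‖x‖ : ℂ) ^ 2).re = -((b δ).re * ‖x‖ ^ 2) := by
        rw [← Complex.ofReal_pow, Complex.re_mul_ofReal, Complex.neg_re]; ring
      rw [this]
      nlinarith [mul_nonneg hδ.le (sq_nonneg ‖x‖)]
    · refine .of_forall fun x => ?_
      have : Continuous fun z : ℂ => Complex.exp (-z * ‖x‖ ^ 2) * wave ħ (inner ℝ v x) *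
          (𝓕 θ) (ε • x) := by fun_prop
      exact (this.tendsto b0).comp hbt
  have hR : Tendsto (fun δ => (Real.pi / b δ) ^ (finrank ℝ E / 2 : ℂ) * ∫ w, θ w * Complex.exp
        ((Complex.I / ħ) ^ 2 * ‖v - (2 * Real.pi * ħ * ε) • w‖ ^ 2 / (4 * b δ))) (𝓝[>] 0)
      (𝓝 ((Real.pi / b0) ^ (finrank ℝ E / 2 : ℂ) * ∫ w, θ w * Complex.exp
        ((Complex.I / ħ) ^ 2 * ‖v - (2 * Real.pi * ħ * ε) • w‖ ^ 2 / (4 * b0)))) := by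
    refine Tendsto.mul ?_ ?_
    -- The limit `π / b0 = 2πħ i` is off the branch cut, so the principal power is continuous there;
    -- its value cancels against `fresnelConst`.
    · have h1 : (Real.pi / b0 : ℂ) ∈ Complex.slitPlane := by
        have : (Real.pi / b0 : ℂ) = ((2 * Real.pi * ħ : ℝ) : ℂ) * Complex.I := by
          rw [hb0]; push_cast; field_simp; rw [Complex.I_sq]
        rw [this, Complex.mem_slitPlane_iff]
        right
        simp [hħ.ne', Real.pi_ne_zero]
      exact (continuousAt_cpow_const h1).tendsto.comp (tendsto_const_nhds.div hbt hb0ne)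
    · refine tendsto_integral_filter_of_dominated_convergence (fun w => ‖θ w‖) ?_ ?_
        θ.integrable.norm ?_
      · refine .of_forall fun δ => Continuous.aestronglyMeasurable ?_
        have := θ.continuous
        fun_prop
      · filter_upwards [hev] with δ hδ
        refine .of_forall fun w => ?_
        rw [norm_mul]
        refine mul_le_of_le_one_right (norm_nonneg _) ?_
        rw [Complex.norm_exp, Real.exp_le_one_iff]
        set r := ‖v - (2 * Real.pi * ħ * ε) • w‖
        have : (Complex.I / ħ) ^ 2 * (r : ℂ) ^ 2 / (4 * b δ) =
            ((-(r ^ 2 / (4 * ħ ^ 2)) : ℝ) : ℂ) * (b δ)⁻¹ := by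
          push_cast
          rw [div_pow, Complex.I_sq]
          field_simp
        rw [this, Complex.re_ofReal_mul, Complex.inv_re]
        have h1 : 0 ≤ (b δ).re / Complex.normSq (b δ) := div_nonneg hδ.le (Complex.normSq_nonneg _)
        have h2 : 0 ≤ r ^ 2 / (4 * ħ ^ 2) := by positivity
        nlinarith [mul_nonneg h1 h2]
      · refine .of_forall fun w => (tendsto_const_nhds.mul ?_)
        exact (Complex.continuous_exp.tendsto _).comp
          (tendsto_const_nhds.div (hbt.const_mul 4) (by simpa using hb0ne))
  have heq := tendsto_nhds_unique (hL.congr' (by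
    filter_upwards [hev] with δ hδ
    exact integral_gaussian_mul_fourier hħ θ ε v hδ)) hR
  have e1 : (Real.pi / b0 : ℂ) = 2 * Real.pi * Complex.I * ħ := by
    rw [hb0]; field_simp; rw [Complex.I_sq]
  have e2 : ∀ w, Complex.exp ((Complex.I / ħ) ^ 2 * ‖v - (2 * Real.pi * ħ * ε) • w‖ ^ 2 / (4 * b0)) =
      wave ħ (-(‖v - (2 * Real.pi * ħ * ε) • w‖ ^ 2 / 2)) := by
    intro w
    rw [wave]
    congr 1
    rw [hb0]
    push_cast
    field_simp
    norm_num
  have e3 : ∀ x : E, fresnelFun ħ x * (𝓕 θ) (ε • x) * wave ħ (inner ℝ v x) = fresnelConst ħ E *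
      (Complex.exp (-b0 * ‖x‖ ^ 2) * wave ħ (inner ℝ v x) * (𝓕 θ) (ε • x)) := by
    intro x
    have : Complex.exp (-b0 * ‖x‖ ^ 2) = Complex.exp (Complex.I / (2 * ħ) * (‖x‖ ^ 2 : ℝ)) := by
      congr 1; rw [hb0]; push_cast; ring
    rw [this, fresnelFun]
    ring
  simp only [e2, e1] at heq
  simp only [e3]
  rw [integral_const_mul, heq, ← mul_assoc, fresnelConst_mul_cpow hħ, one_mul]

end Euclidean

/-! ### The Gabor transform of a Fourier transform -/

/-- The inverse `ħ`-Fourier transform of a window. -/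
def dualWindow (ħ : ℝ) (hħ : 0 < ħ) (γ : 𝓢(ℝ, ℂ)) : 𝓢(ℝ, ℂ) :=
  conjSchwartz (fourierSchwartz ħ hħ (conjSchwartz γ))

theorem conj_planckConst (ħ : ℝ) : conj (planckConst ħ ℝ) = planckConst ħ ℝ := by
  simp only [planckConst, Complex.conj_ofReal]

theorem fourierSchwartz_eq_oscInt (ħ : ℝ) (hħ : 0 < ħ) (φ : 𝓢(ℝ, ℂ)) (ξ : ℝ) :
    fourierSchwartz ħ hħ φ ξ = planckConst ħ ℝ * oscInt ħ φ ξ := by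
  rw [fourierSchwartz_apply, oscInt]
  congr 1
  refine integral_congr_ae (.of_forall fun y => ?_)
  simp only [wave]
  rw [mul_comm]
  congr 2
  push_cast
  ring

theorem dualWindow_apply (ħ : ℝ) (hħ : 0 < ħ) (γ : 𝓢(ℝ, ℂ)) (t : ℝ) :
    dualWindow ħ hħ γ t = planckConst ħ ℝ * chirpInt ħ γ 0 0 t := by
  rw [dualWindow, conjSchwartz_apply, fourierSchwartz_eq_oscInt, map_mul, conj_planckConst,
    oscInt_real, ← integral_conj, chirpInt]
  refine congrArg _ (integral_congr_ae (.of_forall fun y => ?_))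
  simp only [map_mul, conjSchwartz_apply, Complex.conj_conj, conj_wave, neg_neg, sub_zero]
  congr 2
  ring

theorem chirpInt_zero_eq {ħ : ℝ} (hħ : 0 < ħ) (g : 𝓢(ℝ, ℂ)) (η s : ℝ) :
    planckConst ħ ℝ * chirpInt ħ g 0 η s = wave ħ (η * s) * dualWindow ħ hħ g s := by
  rw [dualWindow_apply, chirpInt_eq_oscInt, chirpInt_eq_oscInt]
  simp
  ring

/-- Plancherel: passing to dual windows preserves the inner product. -/
theorem integral_dualWindow {ħ : ℝ} (hħ : 0 < ħ) (g γ : 𝓢(ℝ, ℂ)) :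
    ∫ y, dualWindow ħ hħ g y * conj (dualWindow ħ hħ γ y) = innerSchwartz g γ := by
  have hpos : 0 < 2 * Real.pi * ħ := by positivity
  have h1 := SchwartzMap.integral_inner_fourier_fourier (conjSchwartz g) (conjSchwartz γ)
  have h2 := Measure.integral_comp_mul_left
    (fun y => inner ℂ ((𝓕 (conjSchwartz g)) y) ((𝓕 (conjSchwartz γ)) y)) (2 * Real.pi * ħ)⁻¹
  rw [inv_inv, abs_of_pos hpos, h1] at h2
  have h3 : innerSchwartz g γ = ∫ x, inner ℂ (conjSchwartz g x) (conjSchwartz γ x) := by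
    rw [innerSchwartz]
    refine integral_congr_ae (.of_forall fun y => ?_)
    simp [RCLike.inner_apply, mul_comm]
  have h4 : ∀ y, dualWindow ħ hħ g y * conj (dualWindow ħ hħ γ y) = planckConst ħ ℝ ^ 2 *
      inner ℂ ((𝓕 (conjSchwartz g)) ((2 * Real.pi * ħ)⁻¹ * y))
        ((𝓕 (conjSchwartz γ)) ((2 * Real.pi * ħ)⁻¹ * y)) := by
    intro y
    simp only [dualWindow, conjSchwartz_apply, Complex.conj_conj, fourierSchwartz_eq_oscInt,
      oscInt_eq_fourier, map_mul, conj_planckConst, RCLike.inner_apply, smul_eq_mul]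
    simp only [SchwartzMap.fourier_coe]
    ring
  simp only [h4]
  rw [integral_const_mul, h2, ← h3, planckConst_sq hħ, Complex.real_smul, ← mul_assoc,
    ← Complex.ofReal_mul, inv_mul_cancel₀ hpos.ne', Complex.ofReal_one, one_mul]

/-- The Fourier transform acts on phase space as a quarter turn, up to a phase: position `η` of the
transform is frequency `η` of `h`. -/
theorem Represents.stft_fourierDist {ħ : ℝ} (hħ : 0 < ħ) {h : ℝ → ℂ} {u : 𝓢'(ℝ, ℂ)}
    (hu : Represents h u) (γ : 𝓢(ℝ, ℂ)) (η s : ℝ) :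
    stft ħ γ (fourierDist ħ hħ u) η s =
      wave ħ (-(s * η)) * stftFun ħ (dualWindow ħ hħ γ) h (-s) η := by
  have h0 : stft ħ γ (fourierDist ħ hħ u) η s =
      u (fourierSchwartz ħ hħ (conjSchwartz (phaseShift ħ η s γ))) := rfl
  rw [h0, (hu _).2, stftFun_eq, oscInt_real, ← integral_const_mul, ← integral_const_mul]
  refine integral_congr_ae (.of_forall fun y => ?_)
  have h1 : oscInt ħ (conjSchwartz (phaseShift ħ η s γ)) y =
      planckConst ħ ℝ * (wave ħ (-((y + s) * η)) * oscInt ħ (conjSchwartz γ) (y + s)) := by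
    have h2 := oscInt_comp_sub ħ (fun z => conjSchwartz γ z) η (y + s)
    simp only [RCLike.inner_apply, conj_trivial, mul_comm η] at h2
    rw [← h2, oscInt_real, oscInt_real, ← integral_const_mul]
    refine integral_congr_ae (.of_forall fun z => ?_)
    have h3 : Complex.exp (Complex.I / ħ * (inner ℝ s z : ℝ)) = wave ħ (inner ℝ s z : ℝ) := rfl
    simp only [conjSchwartz_apply, phaseShift_apply, map_mul, conj_planckConst, h3, conj_wave]
    rw [show -((y + s) * z) = -(inner ℝ s z : ℝ) + -(y * z) by
      simp only [RCLike.inner_apply, conj_trivial]; ring, wave_add]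
    ring
  simp only [fourierSchwartz_eq_oscInt, h1, dualWindow, conjSchwartz_apply, Complex.conj_conj,
    sub_neg_eq_add]
  rw [show -((y + s) * η) = -(s * η) + -(η * y) by ring, wave_add]
  ring

/-! ### Reproducing formula -/

theorem stronglyMeasurable_stftFun (ħ : ℝ) {h : ℝ → ℂ} (hc : Continuous h) (g : 𝓢(ℝ, ℂ)) :
    StronglyMeasurable fun z : ℝ × ℝ => stftFun ħ g h z.1 z.2 := by
  simp only [stftFun_eq, oscInt_real]
  have hg := g.continuous
  refine StronglyMeasurable.const_mul (StronglyMeasurable.integral_prod_right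
    (f := fun (z : ℝ × ℝ) y => h y * conj (g (y - z.1)) * wave ħ (-(z.2 * y)))
    (Continuous.stronglyMeasurable ?_)) _
  have hcj := Complex.continuous_conj
  simp only [Function.uncurry_def]
  exact ((hc.comp continuous_snd).mul (hcj.comp (hg.comp (by fun_prop)))).mul (by fun_prop)

theorem integrable_prod_mul_kernel {W : ℝ → ℝ} (hW : Integrable W) (a : ℝ) :
    Integrable fun z : ℝ × ℝ => W z.1 * (1 + (z.2 - a * z.1) ^ 2)⁻¹ := by
  have hK := integrable_inv_one_add_sq
  have hmeas : AEStronglyMeasurable (fun z : ℝ × ℝ => W z.1 * (1 + (z.2 - a * z.1) ^ 2)⁻¹)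
      (volume.prod volume) := by
    refine hW.1.comp_fst.mul (Continuous.aestronglyMeasurable ?_)
    exact Continuous.inv₀ (by fun_prop) fun z => by positivity
  refine (integrable_prod_iff hmeas).2 ⟨.of_forall fun η => ?_, ?_⟩
  · exact (hK.comp_sub_right (a * η)).const_mul (W η)
  · simp only [norm_mul]
    simp_rw [integral_const_mul]
    have : ∀ η : ℝ, (∫ y : ℝ, ‖(1 + (y - a * η) ^ 2)⁻¹‖) = ∫ y : ℝ, ‖(1 + y ^ 2)⁻¹‖ := fun η =>
      integral_sub_right_eq_self (fun y : ℝ => ‖(1 + y ^ 2)⁻¹‖) (a * η)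
    simp_rw [this]
    exact hW.norm.mul_const _

/-- Bounded continuous functions with dominated Gabor transform are superpositions of wave packets,
where `U` is the Gabor transform of the Fourier transform of `h`. -/
theorem innerSchwartz_mul_eq_integral {ħ : ℝ} (hħ : 0 < ħ) {h : ℝ → ℂ} (hc : Continuous h)
    {B : ℝ} (hB : ∀ y, ‖h y‖ ≤ B) (g γ : 𝓢(ℝ, ℂ)) {U : ℝ × ℝ → ℂ}
    (hU : ∀ η s, U (η, s) = wave ħ (-(s * η)) * stftFun ħ (dualWindow ħ hħ γ) h (-s) η)
    (hUm : AEStronglyMeasurable U) {W : ℝ → ℝ} (hW : Integrable W) (hUW : ∀ z, ‖U z‖ ≤ W z.1)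
    (y : ℝ) :
    innerSchwartz g γ * h y =
      planckConst ħ ℝ ^ 2 * ∫ z : ℝ × ℝ, U z * chirpInt ħ g 0 z.1 (y + z.2) := by
  have hh := integrable_schwartz_mul hc hB
  set c := planckConst ħ ℝ with hcdef
  set g' := dualWindow ħ hħ g with hg'
  set γ' := dualWindow ħ hħ γ with hγ'
  obtain ⟨C, hC0, hC⟩ := exists_chirpInt_decay hħ g 0
  have hC' : ∀ η s, ‖chirpInt ħ g 0 η s‖ ≤ C * (1 + s ^ 2)⁻¹ := fun η s => by
    have := hC 0 (by simp) η s
    simpa using this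
  have hint : Integrable fun z : ℝ × ℝ => U z * chirpInt ħ g 0 z.1 (y + z.2) := by
    refine Integrable.mono' (((integrable_prod_mul_kernel hW 0).const_mul
      (C * (2 * (1 + y ^ 2))))) ?_ (.of_forall fun z => ?_)
    · exact hUm.mul ((continuous_chirpInt ħ g 0).comp
        (by fun_prop : Continuous fun z : ℝ × ℝ => (z.1, y + z.2))).aestronglyMeasurable
    · rw [norm_mul]
      have h1 := inv_one_add_sq_add_le z.2 y
      calc _ ≤ W z.1 * (C * (2 * (1 + y ^ 2) * (1 + z.2 ^ 2)⁻¹)) := by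
            refine mul_le_mul (hUW z) ((hC' _ _).trans ?_) (norm_nonneg _)
              ((norm_nonneg _).trans (hUW z))
            rw [add_comm y]
            gcongr
        _ = _ := by simp only [zero_mul, sub_zero]; ring
  -- Inversion in `η` for each fixed `s` recovers `h y` times a product of dual windows at `y + s`;
  -- integrating over `s` then produces `innerSchwartz g γ`.
  have hslice : ∀ s, h y * (g' (y + s) * conj (γ' (y + s))) =
      c ^ 2 * ∫ η, U (η, s) * chirpInt ħ g 0 η (y + s) := by
    intro s
    have hV : Integrable (stftFun ħ γ' h (-s)) := by
      refine hW.mono' (continuous_stftFun ħ hh γ' _).aestronglyMeasurable (.of_forall fun η => ?_)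
      have := hUW (η, s)
      rwa [hU, norm_mul, norm_wave, one_mul] at this
    have h1 := mul_conj_eq_integral_stftFun hħ hc hh γ' (-s) hV y
    rw [sub_neg_eq_add] at h1
    calc _ = g' (y + s) * (h y * conj (γ' (y + s))) := by ring
      _ = c * ∫ η, g' (y + s) * (stftFun ħ γ' h (-s) η * wave ħ (η * y)) := by
          rw [h1, integral_const_mul]; ring
      _ = _ := by
          rw [sq, mul_assoc]
          refine congrArg _ ?_
          rw [← integral_const_mul]
          refine integral_congr_ae (.of_forall fun η => ?_)
          simp only
          rw [mul_left_comm c, chirpInt_zero_eq hħ, hU, mul_add η, wave_add, mul_comm s η]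
          have : wave ħ (-(η * s)) * wave ħ (η * s) = 1 := by rw [← wave_add]; simp
          linear_combination (-(g' (y + s) * stftFun ħ γ' h (-s) η * wave ħ (η * y))) * this
  have h2 : ∫ s, g' (y + s) * conj (γ' (y + s)) = innerSchwartz g γ := by
    rw [← integral_dualWindow hħ, integral_add_left_eq_self (fun t => g' t * conj (γ' t)) y]
  rw [Measure.volume_eq_prod, integral_prod_symm _ hint, ← integral_const_mul, ← h2, mul_comm,
    ← integral_const_mul]
  exact integral_congr_ae (.of_forall hslice)

/-! ### Fresnel integrals of ridge functions -/

section Euclidean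

variable {E : Type*} [NormedAddCommGroup E] [InnerProductSpace ℝ E] [FiniteDimensional ℝ E]
  [MeasurableSpace E] [BorelSpace E]

theorem integrable_fresnelFun_mul (ħ : ℝ) (φ : 𝓢(E, ℂ)) {ε : ℝ} (hε : ε ≠ 0) :
    Integrable fun x => fresnelFun ħ x * φ (ε • x) :=
  ((integrable_comp_smul_iff volume _ hε).2 φ.integrable).bdd_mul
    (continuous_fresnelFun ħ).aestronglyMeasurable (.of_forall fun x => (norm_fresnelFun ħ x).le)

/-- The cutoff can absorb a quadratic weight. This pays for the factor that Peetre's inequality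
produces when `chirpInt ħ g 0` is shifted by `κ·x`. -/
theorem integrable_fresnelFun_mul_weight (ħ : ℝ) (φ : 𝓢(E, ℂ)) {ε : ℝ} (hε : ε ≠ 0) (κ : E) :
    Integrable fun x => fresnelFun ħ x * φ (ε • x) * ((1 + (inner ℝ κ x : ℝ) ^ 2 : ℝ) : ℂ) := by
  -- The division by `ε²` undoes the dilation `x ↦ ε x` in the argument of `φ`.
  have h1 : (fun x : E => ((1 + (inner ℝ κ x : ℝ) ^ 2 / ε ^ 2 : ℝ) : ℂ)).HasTemperateGrowth := by
    refine Function.HasTemperateGrowth.comp Function.Complex.hasTemperateGrowth_ofReal ((Function.HasTemperateGrowth.const _).add ?_)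
    simp only [div_eq_mul_inv]
    exact ((Function.hasTemperateGrowth_inner_right κ).pow 2).mul
      (Function.HasTemperateGrowth.const _)
  refine (integrable_fresnelFun_mul ħ (SchwartzMap.smulLeftCLM ℂ
    (fun x : E => ((1 + (inner ℝ κ x : ℝ) ^ 2 / ε ^ 2 : ℝ) : ℂ)) φ) hε).congr
    (.of_forall fun x => ?_)
  simp only [SchwartzMap.smulLeftCLM_apply_apply h1, smul_eq_mul, inner_smul_right]
  rw [mul_pow, mul_div_cancel_left₀ _ (pow_ne_zero 2 hε)]
  ring

/-- A chirp with parameter `0` is a superposition of plane waves of frequency `ζκ`. The Fresnel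
integral gives each one the phase of `-‖ζκ - v‖²/2`: its `ζ²` term creates the parameter `‖κ‖`, and
its cross term shifts `s` by `κ·v`. -/
theorem integral_fresnelFun_mul_chirpInt {ħ : ℝ} (hħ : 0 < ħ) (θ : 𝓢(E, ℂ)) {ε : ℝ} (hε : ε ≠ 0)
    (κ : E) (g : 𝓢(ℝ, ℂ)) (η s : ℝ) :
    ∫ x, fresnelFun ħ x * (𝓕 θ) (ε • x) * chirpInt ħ g 0 η (inner ℝ κ x + s) =
      ∫ w, θ w * (wave ħ (-(‖(2 * Real.pi * ħ * ε) • w‖ ^ 2 / 2)) *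
        chirpInt ħ g ‖κ‖ η (s + inner ℝ κ ((2 * Real.pi * ħ * ε) • w))) := by
  have hg : Integrable fun ζ => g (ζ - η) := g.integrable.comp_sub_right η
  set v : E → E := fun w => (2 * Real.pi * ħ * ε) • w with hv
  have h1 : ∀ x, chirpInt ħ g 0 η (inner ℝ κ x + s) =
      ∫ ζ, g (ζ - η) * wave ħ (ζ * (inner ℝ κ x + s)) := by
    intro x; simp [chirpInt]
  simp only [h1]
  rw [integral_mul_integral_swap (integrable_fresnelFun_mul ħ (𝓕 θ) hε) hg
    (q := fun x ζ => wave ħ (ζ * (inner ℝ κ x + s))) (C := 1)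
    (by fun_prop : Continuous (Function.uncurry fun (x : E) (ζ : ℝ) =>
      wave ħ (ζ * (inner ℝ κ x + s)))).aestronglyMeasurable (fun x ζ => by simp)]
  have h2 : ∀ ζ : ℝ, (∫ x, fresnelFun ħ x * (𝓕 θ) (ε • x) * wave ħ (ζ * (inner ℝ κ x + s))) =
      ∫ w, θ w * wave ħ (ζ * s - ‖ζ • κ - v w‖ ^ 2 / 2) := by
    intro ζ
    have h3 := integral_fresnelFun_mul_wave hħ θ hε (ζ • κ)
    calc _ = wave ħ (ζ * s) *
          ∫ x, fresnelFun ħ x * (𝓕 θ) (ε • x) * wave ħ (inner ℝ (ζ • κ) x) := by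
          rw [← integral_const_mul]
          refine integral_congr_ae (.of_forall fun x => ?_)
          simp only [mul_add, wave_add, real_inner_smul_left]
          ring
      _ = _ := by
          rw [h3, ← integral_const_mul]
          refine integral_congr_ae (.of_forall fun w => ?_)
          simp only [sub_eq_add_neg (ζ * s), wave_add, hv]
          ring
  simp only [h2]
  rw [integral_mul_integral_swap hg θ.integrable
    (q := fun ζ w => wave ħ (ζ * s - ‖ζ • κ - v w‖ ^ 2 / 2)) (C := 1)
    (by simp only [hv]; fun_prop : Continuous (Function.uncurry fun (ζ : ℝ) (w : E) =>
      wave ħ (ζ * s - ‖ζ • κ - v w‖ ^ 2 / 2))).aestronglyMeasurable (fun x ζ => by simp)]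
  refine integral_congr_ae (.of_forall fun w => ?_)
  simp only [chirpInt]
  refine congrArg _ ?_
  rw [← integral_const_mul]
  refine integral_congr_ae (.of_forall fun ζ => ?_)
  simp only
  rw [mul_left_comm, ← wave_add]
  congr 2
  rw [norm_sub_sq_real, norm_smul, real_inner_smul_left, mul_pow, Real.norm_eq_abs, sq_abs]
  ring

/-- The principal logarithm of `i` is `iπ/2`, so the square root contributes the phase `π/4`. -/
theorem conj_fresnelConst {ħ : ℝ} (hħ : 0 < ħ) :
    conj (fresnelConst ħ ℝ) = Complex.exp (Real.pi / 4 * Complex.I) * planckConst ħ ℝ := by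
  have h0 : (0 : ℝ) < 2 * Real.pi * ħ := by positivity
  have h1 : (2 * Real.pi * Complex.I * ħ : ℂ) = ((2 * Real.pi * ħ : ℝ) : ℂ) * Complex.I := by
    push_cast; ring
  have h2 : fresnelConst ħ ℝ = planckConst ħ ℝ * Complex.exp (-(Real.pi / 4 * Complex.I)) := by
    rw [fresnelConst, planckConst, h1, Complex.ofReal_cpow h0.le,
      Complex.cpow_def_of_ne_zero (by simp [Real.pi_ne_zero, hħ.ne']),
      Complex.cpow_def_of_ne_zero (by exact_mod_cast h0.ne'),
      Complex.log_ofReal_mul h0 Complex.I_ne_zero, Complex.log_I, ← Complex.exp_add,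
      Complex.ofReal_log h0.le]
    congr 1
    simp only [finrank_self]
    push_cast
    ring
  rw [h2, map_mul, conj_planckConst, ← Complex.exp_conj, mul_comm]
  congr 2
  simp [map_ofNat (starRingEnd ℂ) 4]

theorem exp_mul_chirpConst {ħ : ℝ} (hħ : 0 < ħ) :
    Complex.exp (-(Real.pi / 4 * Complex.I)) * chirpConst ħ = planckConst ħ ℝ ^ 2 := by
  rw [chirpConst, conj_fresnelConst hħ, ← mul_assoc, ← mul_assoc, ← Complex.exp_add]
  simp [sq]

/-- Ridge functions with profile in the Sjöstrand class are Fresnel integrable. -/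
theorem hasFresnelIntegral_comp_inner {ħ : ℝ} (hħ : 0 < ħ) {h : ℝ → ℂ} (hc : Continuous h)
    {B : ℝ} (hB : ∀ y, ‖h y‖ ≤ B) {g γ : 𝓢(ℝ, ℂ)} (hgγ : innerSchwartz g γ ≠ 0) {U : ℝ × ℝ → ℂ}
    (hU : ∀ η s, U (η, s) = wave ħ (-(s * η)) * stftFun ħ (dualWindow ħ hħ γ) h (-s) η)
    (hUm : AEStronglyMeasurable U) {W : ℝ → ℝ} (hW : Integrable W) (hUW : ∀ z, ‖U z‖ ≤ W z.1)
    (κ : E) :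
    HasFresnelIntegral ħ (fun x : E => h (inner ℝ κ x))
      (Complex.exp (-(Real.pi / 4 * Complex.I)) *
        ((innerSchwartz g γ)⁻¹ * phaseFunctional ħ g ‖κ‖ U)) := by
  intro φ hφ
  have hcκ : Continuous fun x : E => h (inner ℝ κ x) := hc.comp (by fun_prop)
  have hW0 : ∀ η, 0 ≤ W η := fun η => (norm_nonneg _).trans (hUW (η, 0))
  refine ⟨fun ε hε => ?_, ?_⟩
  · refine ((integrable_fresnelFun_mul ħ φ hε.ne').mul_bdd hcκ.aestronglyMeasurable
      (.of_forall fun x => hB _)).congr (.of_forall fun x => ?_)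
    simp only; ring
  -- Writing the cutoff as a Fourier transform turns `φ 0 = 1` into `∫ θ = 1`, so `θ` acts as an
  -- averaging weight.
  set θ : 𝓢(E, ℂ) := 𝓕⁻ φ with hθ
  have hφθ : 𝓕 θ = φ := by rw [hθ]; simp
  have hθ1 : ∫ w, θ w = 1 := by
    rw [← hφ, ← hφθ, SchwartzMap.fourier_coe, Real.fourier_eq']
    simp
  set c := planckConst ħ ℝ with hcdef
  obtain ⟨C, hC0, hC⟩ := exists_chirpInt_decay hħ g ‖κ‖
  have hCκ := hC ‖κ‖ (by simp)
  have hC' : ∀ η s, ‖chirpInt ħ g 0 η s‖ ≤ C * (1 + s ^ 2)⁻¹ := fun η s => by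
    have := hC 0 (by simp) η s
    simpa using this
  set v : ℝ → E → E := fun ε w => (2 * Real.pi * ħ * ε) • w with hv
  set G : ℝ → ℝ × ℝ → ℂ := fun ε z => ∫ w, θ w * (wave ħ (-(‖v ε w‖ ^ 2 / 2)) *
    chirpInt ħ g ‖κ‖ z.1 (z.2 + inner ℝ κ (v ε w))) with hG
  have hrep : ∀ ε : ℝ, 0 < ε → innerSchwartz g γ *
      ∫ x, fresnelFun ħ x * h (inner ℝ κ x) * φ (ε • x) = c ^ 2 * ∫ z, U z * G ε z := by
    intro ε hε
    have hBint : Integrable fun z : ℝ × ℝ => U z * (((1 + z.2 ^ 2)⁻¹ : ℝ) : ℂ) := by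
      refine (integrable_prod_mul_kernel hW 0).mono' ?_ (.of_forall fun z => ?_)
      · refine hUm.mul (Continuous.aestronglyMeasurable ?_)
        refine Complex.continuous_ofReal.comp (Continuous.inv₀ (by fun_prop) fun z => by positivity)
      · rw [norm_mul, Complex.norm_real, Real.norm_of_nonneg (by positivity)]
        simp only [zero_mul, sub_zero]
        gcongr
        exact hUW z
    -- `U` need not be integrable in `s`, so Fubini is applied after moving weights: `(1 + s²)⁻¹`
    -- goes to `U`, `1 + (κ·x)²` to the cutoff, and Peetre's inequality keeps the compensated kernel
    -- `q` bounded.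
    set q : E → ℝ × ℝ → ℂ := fun x z => chirpInt ħ g 0 z.1 (inner ℝ κ x + z.2) *
      (((1 + z.2 ^ 2) * (1 + (inner ℝ κ x : ℝ) ^ 2)⁻¹ : ℝ) : ℂ) with hq
    have hqm : Continuous (Function.uncurry q) := by
      simp only [hq, Function.uncurry_def]
      refine ((continuous_chirpInt ħ g 0).comp (by fun_prop : Continuous fun p : E × (ℝ × ℝ) =>
        (p.2.1, (inner ℝ κ p.1 : ℝ) + p.2.2))).mul (Complex.continuous_ofReal.comp ?_)
      exact Continuous.mul (by fun_prop) (Continuous.inv₀ (by fun_prop) fun z => by positivity)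
    have hqb : ∀ x z, ‖q x z‖ ≤ 2 * C := by
      intro x z
      rw [hq, norm_mul, Complex.norm_real, Real.norm_of_nonneg (by positivity)]
      have h1 := inv_one_add_sq_add_le z.2 (inner ℝ κ x : ℝ)
      calc _ ≤ C * (2 * (1 + (inner ℝ κ x : ℝ) ^ 2) * (1 + z.2 ^ 2)⁻¹) *
            ((1 + z.2 ^ 2) * (1 + (inner ℝ κ x : ℝ) ^ 2)⁻¹) := by
            gcongr
            refine (hC' _ _).trans ?_
            rw [add_comm (inner ℝ κ x : ℝ)]
            gcongr
        _ = _ := by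
            have e1 : (1 + z.2 ^ 2) ≠ 0 := by positivity
            have e2 : (1 + (inner ℝ κ x : ℝ) ^ 2) ≠ 0 := by positivity
            field_simp
    have hswap := integral_mul_integral_swap (integrable_fresnelFun_mul_weight ħ φ hε.ne' κ) hBint
      hqm.aestronglyMeasurable hqb
    have hcancel : ∀ (x : E) (z : ℝ × ℝ) (a b : ℂ),
        a * ((1 + (inner ℝ κ x : ℝ) ^ 2 : ℝ) : ℂ) * (b * (((1 + z.2 ^ 2)⁻¹ : ℝ) : ℂ)) * q x z =
          a * (b * chirpInt ħ g 0 z.1 (inner ℝ κ x + z.2)) := by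
      intro x z a b
      have e1 : ((1 + (inner ℝ κ x : ℝ) ^ 2 : ℝ) : ℂ) ≠ 0 := by
        have : (1 + (inner ℝ κ x : ℝ) ^ 2) ≠ 0 := by positivity
        exact_mod_cast this
      have e2 : ((1 + z.2 ^ 2 : ℝ) : ℂ) ≠ 0 := by
        have : (1 + z.2 ^ 2) ≠ 0 := by positivity
        exact_mod_cast this
      simp only [hq, Complex.ofReal_mul, Complex.ofReal_inv]
      field_simp
    have hl : innerSchwartz g γ * ∫ x, fresnelFun ħ x * h (inner ℝ κ x) * φ (ε • x) =
        c ^ 2 * ∫ x, fresnelFun ħ x * φ (ε • x) * ((1 + (inner ℝ κ x : ℝ) ^ 2 : ℝ) : ℂ) *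
          ∫ z, U z * (((1 + z.2 ^ 2)⁻¹ : ℝ) : ℂ) * q x z := by
      rw [← integral_const_mul, ← integral_const_mul]
      refine integral_congr_ae (.of_forall fun x => ?_)
      have h1 := innerSchwartz_mul_eq_integral hħ hc hB g γ hU hUm hW hUW (inner ℝ κ x)
      simp only
      calc _ = fresnelFun ħ x * φ (ε • x) * (innerSchwartz g γ * h (inner ℝ κ x)) := by ring
        _ = c ^ 2 * ∫ z : ℝ × ℝ, fresnelFun ħ x * φ (ε • x) *
            (U z * chirpInt ħ g 0 z.1 (inner ℝ κ x + z.2)) := by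
            rw [h1, integral_const_mul]; ring
        _ = _ := by
            refine congrArg _ ?_
            rw [← integral_const_mul (μ := volume) (fresnelFun ħ x * φ (ε • x) *
              ((1 + (inner ℝ κ x : ℝ) ^ 2 : ℝ) : ℂ))]
            refine integral_congr_ae (.of_forall fun z => ?_)
            simp only [← hcancel]
            ring
    rw [hl, hswap]
    refine congrArg _ (integral_congr_ae (.of_forall fun z => ?_))
    have h2 := integral_fresnelFun_mul_chirpInt hħ θ hε.ne' κ g z.1 z.2
    rw [hφθ] at h2
    simp only [hG, hv]
    rw [← h2, ← integral_const_mul, ← integral_const_mul]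
    refine integral_congr_ae (.of_forall fun x => ?_)
    simp only
    rw [show ∀ a b c d : ℂ, a * b * (c * d) = c * b * a * d by intros; ring]
    rw [show ∀ a b c d : ℂ, a * b * c * d = c * b * a * d by intros; ring]
    have := hcancel x z (fresnelFun ħ x * φ (ε • x)) (U z)
    linear_combination this
  have hvc : ∀ w, Continuous fun ε => v ε w := fun w => by simp only [hv]; fun_prop
  have hlim : Tendsto (fun ε => ∫ z, U z * G ε z) (𝓝[>] 0)
      (𝓝 (∫ z, U z * chirpInt ħ g ‖κ‖ z.1 z.2)) := by
    set D : ℝ := C * (2 * ∫ w, (1 + (2 * Real.pi * ħ * inner ℝ κ w) ^ 2) * ‖θ w‖) with hD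
    have hweight : Integrable fun w => (1 + (2 * Real.pi * ħ * inner ℝ κ w) ^ 2) * ‖θ w‖ := by
      have h1 : (fun w : E => ((1 + (2 * Real.pi * ħ * inner ℝ κ w) ^ 2 : ℝ) : ℂ)).HasTemperateGrowth :=
        Function.HasTemperateGrowth.comp Function.Complex.hasTemperateGrowth_ofReal ((Function.HasTemperateGrowth.const _).add
          (((Function.HasTemperateGrowth.const _).mul
            (Function.hasTemperateGrowth_inner_right κ)).pow 2))
      refine (SchwartzMap.smulLeftCLM ℂ
        (fun w : E => ((1 + (2 * Real.pi * ħ * inner ℝ κ w) ^ 2 : ℝ) : ℂ)) θ).integrable.norm.congr (.of_forall fun w => ?_)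
      simp only [SchwartzMap.smulLeftCLM_apply_apply h1, smul_eq_mul, norm_mul, Complex.norm_real]
      rw [Real.norm_of_nonneg (by positivity)]
    -- For `ε ≤ 1` the shift `κ·v` is at most its size at `ε = 1`, so Peetre's inequality followed
    -- by integration against `θ` bounds `G ε` uniformly by the chirp kernel.
    have hGb : ∀ ε : ℝ, 0 < ε → ε ≤ 1 → ∀ z : ℝ × ℝ,
        ‖G ε z‖ ≤ D * (1 + (z.2 - ‖κ‖ ^ 2 * z.1) ^ 2)⁻¹ := by
      intro ε hε hε1 z
      have e1 : D * (1 + (z.2 - ‖κ‖ ^ 2 * z.1) ^ 2)⁻¹ =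
          ∫ w, C * 2 * (1 + (z.2 - ‖κ‖ ^ 2 * z.1) ^ 2)⁻¹ *
            ((1 + (2 * Real.pi * ħ * inner ℝ κ w) ^ 2) * ‖θ w‖) := by
        rw [integral_const_mul, hD]; ring
      rw [e1]
      refine norm_integral_le_of_norm_le (hweight.const_mul _) (.of_forall fun w => ?_)
      rw [norm_mul, norm_mul, norm_wave, one_mul]
      set b : ℝ := inner ℝ κ (v ε w) with hb
      have hb2 : b ^ 2 ≤ (2 * Real.pi * ħ * inner ℝ κ w) ^ 2 := by
        have : b = ε * (2 * Real.pi * ħ * inner ℝ κ w) := by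
          rw [hb, hv, inner_smul_right]; ring
        rw [this, mul_pow]
        exact mul_le_of_le_one_left (sq_nonneg _) (pow_le_one₀ hε.le hε1)
      have h1 := inv_one_add_sq_add_le (z.2 - ‖κ‖ ^ 2 * z.1) b
      have h2 : ‖chirpInt ħ g ‖κ‖ z.1 (z.2 + b)‖ ≤
          C * (2 * (1 + (2 * Real.pi * ħ * inner ℝ κ w) ^ 2) *
            (1 + (z.2 - ‖κ‖ ^ 2 * z.1) ^ 2)⁻¹) := by
        refine (hCκ _ _).trans ?_
        rw [add_sub_right_comm]
        gcongr
        refine h1.trans ?_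
        gcongr
      calc _ ≤ ‖θ w‖ * (C * (2 * (1 + (2 * Real.pi * ħ * inner ℝ κ w) ^ 2) *
            (1 + (z.2 - ‖κ‖ ^ 2 * z.1) ^ 2)⁻¹)) := by gcongr
        _ = _ := by ring
    refine tendsto_integral_filter_of_dominated_convergence
      (fun z => D * (W z.1 * (1 + (z.2 - ‖κ‖ ^ 2 * z.1) ^ 2)⁻¹)) ?_ ?_
      ((integrable_prod_mul_kernel hW _).const_mul D) ?_
    · refine .of_forall fun ε => hUm.mul ?_
      refine (StronglyMeasurable.integral_prod_right (f := fun (z : ℝ × ℝ) w => θ w *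
        (wave ħ (-(‖v ε w‖ ^ 2 / 2)) * chirpInt ħ g ‖κ‖ z.1 (z.2 + inner ℝ κ (v ε w))))
        (Continuous.stronglyMeasurable ?_)).aestronglyMeasurable
      simp only [Function.uncurry_def, hv]
      have hθc := θ.continuous
      exact (hθc.comp continuous_snd).mul (Continuous.mul (by fun_prop)
        ((continuous_chirpInt ħ g ‖κ‖).comp (by fun_prop : Continuous fun p : (ℝ × ℝ) × E =>
          (p.1.1, p.1.2 + (inner ℝ κ ((2 * Real.pi * ħ * ε) • p.2) : ℝ)))))
    · filter_upwards [Ioc_mem_nhdsGT one_pos] with ε hε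
      refine .of_forall fun z => ?_
      rw [norm_mul]
      calc _ ≤ W z.1 * (D * (1 + (z.2 - ‖κ‖ ^ 2 * z.1) ^ 2)⁻¹) :=
            mul_le_mul (hUW z) (hGb ε hε.1 hε.2 z) (norm_nonneg _) (hW0 _)
        _ = _ := by ring
    · refine .of_forall fun z => Tendsto.const_mul _ ?_
      -- At `ε = 0` the shifts vanish and only `∫ θ = 1` remains.
      have e1 : chirpInt ħ g ‖κ‖ z.1 z.2 = ∫ w, θ w * (wave ħ (-(‖v 0 w‖ ^ 2 / 2)) *
          chirpInt ħ g ‖κ‖ z.1 (z.2 + inner ℝ κ (v 0 w))) := by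
        simp only [hv, mul_zero, zero_smul, norm_zero, inner_zero_right, add_zero]
        simp [integral_mul_const, hθ1]
      rw [e1]
      refine tendsto_integral_filter_of_dominated_convergence (fun w => C * ‖θ w‖) ?_ ?_
        (θ.integrable.norm.const_mul C) ?_
      · refine .of_forall fun ε => Continuous.aestronglyMeasurable ?_
        simp only [hv]
        have hθc := θ.continuous
        exact hθc.mul (Continuous.mul (by fun_prop)
          ((continuous_chirpInt ħ g ‖κ‖).comp (by fun_prop : Continuous fun w : E =>
            (z.1, z.2 + (inner ℝ κ ((2 * Real.pi * ħ * ε) • w) : ℝ)))))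
      · refine .of_forall fun ε => .of_forall fun w => ?_
        rw [norm_mul, norm_mul, norm_wave, one_mul, mul_comm]
        gcongr
        refine (hCκ _ _).trans (mul_le_of_le_one_right hC0 (inv_le_one_of_one_le₀ ?_))
        nlinarith [sq_nonneg (z.2 + inner ℝ κ (v ε w) - ‖κ‖ ^ 2 * z.1)]
      · refine .of_forall fun w => Tendsto.const_mul _ ?_
        have hcont : Continuous fun ε => wave ħ (-(‖v ε w‖ ^ 2 / 2)) *
            chirpInt ħ g ‖κ‖ z.1 (z.2 + inner ℝ κ (v ε w)) := by
          simp only [hv]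
          exact Continuous.mul (by fun_prop) ((continuous_chirpInt ħ g ‖κ‖).comp
            (by fun_prop : Continuous fun ε : ℝ =>
              (z.1, z.2 + (inner ℝ κ ((2 * Real.pi * ħ * ε) • w) : ℝ))))
        exact (hcont.tendsto 0).mono_left nhdsWithin_le_nhds
  have hval : Complex.exp (-(Real.pi / 4 * Complex.I)) *
      ((innerSchwartz g γ)⁻¹ * phaseFunctional ħ g ‖κ‖ U) =
      (innerSchwartz g γ)⁻¹ * (c ^ 2 * ∫ z, U z * chirpInt ħ g ‖κ‖ z.1 z.2) := by
    have h1 : phaseFunctional ħ g ‖κ‖ U =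
        chirpConst ħ * ∫ z, U z * chirpInt ħ g ‖κ‖ z.1 z.2 := by
      rw [phaseFunctional, ← integral_const_mul]
      refine integral_congr_ae (.of_forall fun z => ?_)
      simp only [phaseIntegrand_eq]
      ring
    rw [h1, hcdef, ← exp_mul_chirpConst hħ]
    ring
  rw [hval]
  refine ((hlim.const_mul (c ^ 2)).const_mul (innerSchwartz g γ)⁻¹).congr' ?_
  filter_upwards [self_mem_nhdsWithin] with ε hε
  rw [← hrep ε hε, inv_mul_cancel_left₀ hgγ]

theorem HasFresnelIntegral.fresnelIntegral_eq {ħ : ℝ} {f : E → ℂ} {I : ℂ}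
    (hf : HasFresnelIntegral ħ f I) : fresnelIntegral ħ f = I := by
  have h : ∃ I, HasFresnelIntegral ħ f I := ⟨I, hf⟩
  obtain ⟨φ, hφ⟩ := exists_schwartz_apply_zero_eq_one E
  rw [fresnelIntegral, dif_pos h]
  exact tendsto_nhds_unique (h.choose_spec φ hφ).2 (hf φ hφ).2

end Euclidean

/-! ### Fourier transforms of complex measures -/

/-- The real and imaginary parts have finite variation by Jordan decomposition, and together they
dominate. -/
theorem isFiniteMeasure_variation {X : Type*} [MeasurableSpace X] (μ : ComplexMeasure X) :
    IsFiniteMeasure μ.variation := by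
  have hre : IsFiniteMeasure (ComplexMeasure.re μ).variation := by
    rw [← SignedMeasure.totalVariation_eq_variation]
    unfold SignedMeasure.totalVariation
    infer_instance
  have him : IsFiniteMeasure (ComplexMeasure.im μ).variation := by
    rw [← SignedMeasure.totalVariation_eq_variation]
    unfold SignedMeasure.totalVariation
    infer_instance
  have hle : μ.variation ≤ (ComplexMeasure.re μ).variation + (ComplexMeasure.im μ).variation := by
    refine VectorMeasure.variation_le_of_forall_enorm_le fun s _ => ?_
    have h1 : μ s = ((ComplexMeasure.re μ s : ℝ) : ℂ) + (ComplexMeasure.im μ s : ℝ) * Complex.I :=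
      (Complex.re_add_im _).symm
    rw [h1, Measure.add_apply]
    refine (enorm_add_le _ _).trans (add_le_add ?_ ?_)
    · refine le_trans (le_of_eq ?_) (VectorMeasure.enorm_measure_le_variation _ s)
      rw [← ofReal_norm, ← ofReal_norm, Complex.norm_real]
    · refine le_trans (le_of_eq ?_) (VectorMeasure.enorm_measure_le_variation _ s)
      rw [← ofReal_norm, ← ofReal_norm, norm_mul, Complex.norm_real, Complex.norm_I, mul_one]
  exact isFiniteMeasure_of_le _ hle

theorem mem_fourierMeasures_iff {H : Type*} [NormedAddCommGroup H] [InnerProductSpace ℝ H]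
    [hm : MeasurableSpace H] [hb : BorelSpace H] {f : H → ℂ} :
    f ∈ fourierMeasures H ↔ ∃ μ : ComplexMeasure H, ∀ x,
      f x = VectorMeasure.integral μ (fun y => Complex.exp (Complex.I * (inner ℝ x y : ℝ)))
        (ContinuousLinearMap.mul ℝ ℂ) := by
  obtain rfl : hm = borel H := hb.measurable_eq
  exact Iff.rfl

theorem integrable_exp_inner {H : Type*} [NormedAddCommGroup H] [InnerProductSpace ℝ H]
    [MeasurableSpace H] [BorelSpace H] (μ : Measure H) [IsFiniteMeasure μ] (x : H) :
    Integrable (fun y => Complex.exp (Complex.I * (inner ℝ x y : ℝ))) μ := by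
  refine Integrable.of_bound (C := 1) ?_ (.of_forall fun y => ?_)
  · have : Continuous fun y : H => Complex.exp (Complex.I * (inner ℝ x y : ℝ)) := by fun_prop
    exact this.measurable.aestronglyMeasurable
  · rw [mul_comm, Complex.norm_exp_ofReal_mul_I]

/-- The representing measure is the image of `μ` under `y ↦ ⟨e, y⟩`. -/
theorem comp_smul_mem_fourierMeasures {H : Type*} [NormedAddCommGroup H] [InnerProductSpace ℝ H]
    {f : H → ℂ} (hf : f ∈ fourierMeasures H) (e : H) :
    (fun t : ℝ => f (t • e)) ∈ fourierMeasures ℝ := by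
  borelize H
  obtain ⟨μ, hμ⟩ := mem_fourierMeasures_iff.1 hf
  have := isFiniteMeasure_variation μ
  have hφ : Measurable fun y : H => (inner ℝ e y : ℝ) :=
    (by fun_prop : Continuous fun y : H => (inner ℝ e y : ℝ)).measurable
  refine mem_fourierMeasures_iff.2 ⟨μ.map fun y => (inner ℝ e y : ℝ), fun t => ?_⟩
  have h1 : ∀ y : H, Complex.exp (Complex.I * (inner ℝ t (inner ℝ e y : ℝ) : ℝ)) =
      Complex.exp (Complex.I * (inner ℝ (t • e) y : ℝ)) := by
    intro y
    rw [real_inner_smul_left, RCLike.inner_apply, conj_trivial, mul_comm t]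
  rw [VectorMeasure.integral_map hφ]
  · simp only [h1]
    exact hμ _
  · exact (by fun_prop : Continuous fun s : ℝ =>
      Complex.exp (Complex.I * (inner ℝ t s : ℝ))).aestronglyMeasurable
  · refine (integrable_exp_inner μ.variation (t • e)).congr (.of_forall fun y => ?_)
    exact (h1 y).symm

theorem ridge_notMem_fourierMeasures {h : ℝ → ℂ} {k : L2seq} (hk : k ≠ 0)
    (hh : h ∉ fourierMeasures ℝ) :
    (fun x : L2seq => ridge h k (x : ℕ → ℝ)) ∉ fourierMeasures L2seq := by
  intro hcon
  refine hh ?_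
  -- The direction `k / ‖k‖²` has inner product `1` with `k`, so restricting the ridge to its line
  -- gives back `h` itself.
  convert comp_smul_mem_fourierMeasures hcon ((‖k‖ ^ 2)⁻¹ • k) using 1
  ext t
  have h1 : ∀ x : L2seq, ridge h k (x : ℕ → ℝ) = h (inner ℝ k x) := fun x => by
    rw [ridge, dif_pos (lp.memℓp x)]
  rw [h1, inner_smul_right, inner_smul_right, real_inner_self_eq_norm_sq,
    inv_mul_cancel₀ (pow_ne_zero 2 (norm_ne_zero_iff.2 hk)), mul_one]

/-! ### A function in the Sjöstrand class which is not the Fourier transform of a measure -/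

theorem tendsto_geom_mean_zero {z : ℂ} (hz : ‖z‖ = 1) (h1 : z ≠ 1) :
    Tendsto (fun N : ℕ => (N : ℝ)⁻¹ • ∑ n ∈ Finset.range N, z ^ n) atTop (𝓝 0) := by
  refine squeeze_zero_norm (a := fun N : ℕ => (N : ℝ)⁻¹ * (2 / ‖z - 1‖)) (fun N => ?_) ?_
  · rw [norm_smul, norm_inv, Real.norm_natCast, geom_sum_eq h1, norm_div]
    gcongr
    refine (norm_sub_le _ _).trans ?_
    rw [norm_pow, hz]
    norm_num
  · simpa using tendsto_inv_atTop_nhds_zero_nat (𝕜 := ℝ) |>.mul_const (2 / ‖z - 1‖)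

/-- For `z = 1` the terms cancel identically; for any other `z` on the unit circle the geometric
sums are bounded. -/
theorem tendsto_mean_pow_sub_inv_pow {z : ℂ} (hz : ‖z‖ = 1) :
    Tendsto (fun N : ℕ => (N : ℝ)⁻¹ • ∑ n ∈ Finset.range N, (z ^ n - z⁻¹ ^ n)) atTop (𝓝 0) := by
  by_cases h1 : z = 1
  · simp [h1]
  · have h2 := (tendsto_geom_mean_zero hz h1).sub (tendsto_geom_mean_zero (z := z⁻¹)
      (by rw [norm_inv, hz, inv_one]) (by simpa using h1))
    simpa [Finset.sum_sub_distrib, smul_sub] using h2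

/-- The Cesàro means of `f(n) - f(-n)` integrate means of `zⁿ - z⁻ⁿ`, `z = e^{iy}`, which are
bounded by `2` and tend to `0` for every `y`; dominated convergence forces the limit to vanish. -/
theorem not_tendsto_of_mem_fourierMeasures {f : ℝ → ℂ} (hf : f ∈ fourierMeasures ℝ) {l : ℂ}
    (hl : Tendsto (fun n : ℕ => f n - f (-n)) atTop (𝓝 l)) : l = 0 := by
  obtain ⟨μ, hμ⟩ := mem_fourierMeasures_iff.1 hf
  have := isFiniteMeasure_variation μ
  have hint := integrable_exp_inner μ.variation
  set e : ℝ → ℝ → ℂ := fun x y => Complex.exp (Complex.I * (inner ℝ x y : ℝ)) with he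
  have hpow : ∀ (n : ℕ) (y : ℝ), e n y = e 1 y ^ n ∧ e (-n) y = (e 1 y)⁻¹ ^ n := by
    intro n y
    simp only [he, RCLike.inner_apply, conj_trivial]
    constructor
    · rw [← Complex.exp_nat_mul]
      congr 1; push_cast; ring
    · rw [← Complex.exp_neg, ← Complex.exp_nat_mul]
      congr 1; push_cast; ring
  have hnorm : ∀ x y, ‖e x y‖ = 1 := fun x y => by
    simp only [he]; rw [mul_comm, Complex.norm_exp_ofReal_mul_I]
  have hi : ∀ n : ℕ, μ.Integrable fun y => e n y - e (-n) y := fun n =>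
    (hint _).sub (hint _)
  have hs : ∀ N : ℕ, (N : ℝ)⁻¹ • ∑ n ∈ Finset.range N, (f n - f (-n)) =
      VectorMeasure.integral μ (fun y => (N : ℝ)⁻¹ • ∑ n ∈ Finset.range N, (e n y - e (-n) y))
        (ContinuousLinearMap.mul ℝ ℂ) := by
    intro N
    rw [VectorMeasure.integral_fun_smul, VectorMeasure.integral_finsetSum _ fun n _ => hi n]
    congr 1
    refine Finset.sum_congr rfl fun n _ => ?_
    rw [VectorMeasure.integral_fun_sub (hint _) (hint _), hμ, hμ]
  have hlim : Tendsto (fun N : ℕ => VectorMeasure.integral μ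
      (fun y => (N : ℝ)⁻¹ • ∑ n ∈ Finset.range N, (e n y - e (-n) y))
      (ContinuousLinearMap.mul ℝ ℂ)) atTop
      (𝓝 (VectorMeasure.integral μ (fun _ => (0 : ℂ)) (ContinuousLinearMap.mul ℝ ℂ))) := by
    refine VectorMeasure.tendsto_integral_of_dominated_convergence (fun _ => 2) (fun N => ?_)
      (integrable_const _) (fun N => .of_forall fun y => ?_) (.of_forall fun y => ?_)
    · exact ((integrable_finsetSum _ fun n _ => hi n).smul ((N : ℝ)⁻¹)).1
    · rw [norm_smul, norm_inv, Real.norm_natCast]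
      have h2 : ‖∑ n ∈ Finset.range N, (e n y - e (-n) y)‖ ≤ N * 2 := by
        refine (norm_sum_le_of_le (n := fun _ => (2 : ℝ)) _ fun n _ => ?_).trans (by simp)
        refine (norm_sub_le _ _).trans ?_
        rw [hnorm, hnorm]; norm_num
      rcases Nat.eq_zero_or_pos N with rfl | hN
      · simp
      · have hN' : (0 : ℝ) < N := by exact_mod_cast hN
        rw [inv_mul_le_iff₀ hN']
        exact h2
    · have h3 := tendsto_mean_pow_sub_inv_pow (hnorm 1 y)
      simpa only [← (hpow _ y).1, ← (hpow _ y).2] using h3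
  simp only [← hs, VectorMeasure.integral_zero] at hlim
  exact tendsto_nhds_unique hl.cesaro_smul hlim

theorem hasTemperateGrowth_arctan : Real.arctan.HasTemperateGrowth := by
  have h1 : (fun x : ℝ => (1 + x ^ 2)⁻¹).HasTemperateGrowth := by
    have := Function.hasTemperateGrowth_one_add_norm_sq_rpow ℝ (-1)
    simpa [Real.rpow_neg_one] using this
  have h2 : fderiv ℝ Real.arctan = fun x => ContinuousLinearMap.toSpanSingleton ℝ (1 + x ^ 2)⁻¹ := by
    ext x
    simp [Real.deriv_arctan]
  refine Function.HasTemperateGrowth.of_fderiv (k := 0) (C := Real.pi) ?_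
    Real.differentiable_arctan fun x => ?_
  · rw [h2]
    exact (ContinuousLinearMap.hasTemperateGrowth
      (ContinuousLinearMap.toSpanSingletonCLE (𝕜 := ℝ) (E := ℝ)).toContinuousLinearMap).comp h1
  · have h3 := Real.neg_pi_div_two_lt_arctan x
    have h4 := Real.arctan_lt_pi_div_two x
    rw [Real.norm_eq_abs, abs_le]
    constructor <;> norm_num <;> linarith [Real.pi_pos]

/-- `arctan` and its first two derivatives are bounded, and translation does not change the bounds,
so the Gabor transform is `O((1 + ξ²)⁻¹)` uniformly in `x`. -/
theorem memSjostrand_arctan {ħ : ℝ} (hħ : 0 < ħ) :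
    MemSjostrand ħ fun x : ℝ => (Real.arctan x : ℂ) := by
  have hc : Continuous fun x : ℝ => (Real.arctan x : ℂ) := by fun_prop
  have hb : ∀ x, ‖(Real.arctan x : ℂ)‖ ≤ 2 := fun x => by
    have h3 := Real.neg_pi_div_two_lt_arctan x
    have h4 := Real.arctan_lt_pi_div_two x
    rw [Complex.norm_real, Real.norm_eq_abs, abs_le]
    constructor <;> linarith [Real.pi_le_four]
  obtain ⟨u, hu⟩ := exists_represents_of_bounded hc hb
  obtain ⟨g, hg⟩ := exists_schwartz_apply_zero_eq_one ℝ
  refine ⟨hc, u, hu, g, fun h0 => by simp [h0] at hg, ?_⟩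
  obtain ⟨C, hC0, hC⟩ := exists_oscInt_decay hħ (conjSchwartz g)
  have hbound : ∀ x ξ, ‖stftFun ħ g (fun x : ℝ => (Real.arctan x : ℂ)) x ξ‖ ≤
      ‖planckConst ħ ℝ‖ * (C * 2 * (1 + ξ ^ 2)⁻¹) := by
    intro x ξ
    rw [stftFun_eq, norm_mul]
    gcongr
    set a : ℝ → ℂ := fun y => (Real.arctan (y + x) : ℂ) with ha
    have e1 : (fun y : ℝ => (Real.arctan y : ℂ) * conj (g (y - x))) =
        fun y => (fun z => a z * conjSchwartz g z) (y - x) := by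
      ext y; simp [ha]
    rw [e1, oscInt_comp_sub ħ (fun z => a z * conjSchwartz g z), norm_mul, norm_wave, one_mul]
    have hgrow : a.HasTemperateGrowth := Function.HasTemperateGrowth.comp
      Function.Complex.hasTemperateGrowth_ofReal (hasTemperateGrowth_arctan.comp
        (Function.HasTemperateGrowth.id'.add (Function.HasTemperateGrowth.const x)))
    have d1 : deriv a = fun y => (((1 + (y + x) ^ 2)⁻¹ : ℝ) : ℂ) := by
      ext y
      have h1 := ((Real.hasDerivAt_arctan (y + x)).comp_add_const y x).ofReal_comp
      rw [h1.deriv]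
      simp
    have d2 : deriv (deriv a) = fun y => ((-(2 * (y + x)) / (1 + (y + x) ^ 2) ^ 2 : ℝ) : ℂ) := by
      rw [d1]
      ext y
      have h1 : HasDerivAt (fun y : ℝ => 1 + (y + x) ^ 2) (2 * (y + x)) y := by
        simpa using ((hasDerivAt_pow 2 (y + x)).comp_add_const y x).const_add 1
      exact ((h1.inv (by positivity)).ofReal_comp).deriv
    have one_le : ∀ y : ℝ, (2 : ℝ) ≤ 2 * (1 + y ^ 2) := fun y => by nlinarith [sq_nonneg y]
    refine hC a hgrow 2 (fun y => (hb _).trans (one_le y)) (fun y => le_trans ?_ (one_le y))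
      (fun y => le_trans ?_ (one_le y)) ξ
    · rw [d1]
      simp only
      rw [Complex.norm_real, Real.norm_of_nonneg (by positivity)]
      exact (inv_le_one_of_one_le₀ (by nlinarith [sq_nonneg (y + x)])).trans one_le_two
    · rw [d2]
      simp only
      rw [Complex.norm_real, norm_div, Real.norm_of_nonneg (sq_nonneg (1 + (y + x) ^ 2)),
        div_le_iff₀ (by positivity), norm_neg, Real.norm_eq_abs, abs_le]
      constructor <;> nlinarith [sq_nonneg (y + x), sq_nonneg (y + x - 1), sq_nonneg (y + x + 1),
        sq_nonneg ((y + x) ^ 2)]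
  have hfinal : Integrable fun ξ : ℝ => ‖planckConst ħ ℝ‖ * (C * 2 * (1 + ξ ^ 2)⁻¹) :=
    (integrable_inv_one_add_sq.const_mul _).const_mul _
  simp only [sjostrandNorm, hu.stft_eq]
  refine lt_of_le_of_lt (lintegral_mono fun ξ => iSup_le fun x => ?_) hfinal.2
  exact enorm_le_iff_norm_le.2 ((hbound x ξ).trans (le_abs_self _))

theorem arctan_notMem_fourierMeasures :
    (fun x : ℝ => (Real.arctan x : ℂ)) ∉ fourierMeasures ℝ := by
  intro hcon
  have h1 : Tendsto (fun n : ℕ => Real.arctan n - Real.arctan (-n)) atTop (𝓝 Real.pi) := by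
    have h2 := (Real.tendsto_arctan_atTop.mono_right nhdsWithin_le_nhds).comp
      (tendsto_natCast_atTop_atTop (R := ℝ))
    have h3 := h2.add h2
    rw [add_halves] at h3
    simpa [Real.arctan_neg, Function.comp_def] using h3
  have h4 := (Complex.continuous_ofReal.tendsto Real.pi).comp h1
  have h5 := not_tendsto_of_mem_fourierMeasures hcon (l := Real.pi) (by
    refine h4.congr fun n => ?_
    simp)
  exact Real.pi_ne_zero (by exact_mod_cast h5)

/-! ### The Gabor transform of the Fourier transform -/

theorem MemSjostrand.exists_majorant {ħ : ℝ} (hħ : 0 < ħ) {h : ℝ → ℂ} (hm : MemSjostrand ħ h)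
    (γ : 𝓢(ℝ, ℂ)) :
    AEStronglyMeasurable
        (fun z : ℝ × ℝ => stft ħ γ (fourierDist ħ hħ (toDist h)) z.1 z.2) ∧
      (∀ η s, stft ħ γ (fourierDist ħ hħ (toDist h)) η s =
        wave ħ (-(s * η)) * stftFun ħ (dualWindow ħ hħ γ) h (-s) η) ∧
      ∃ W : ℝ → ℝ, Integrable W ∧
        ∀ η s, ‖stft ħ γ (fourierDist ħ hħ (toDist h)) η s‖ ≤ W η := by
  obtain ⟨W, hW, hWb⟩ := (hm.bounded_and_dominated hħ).2 (dualWindow ħ hħ γ)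
  have hc := hm.1
  obtain ⟨_, u, hu, _⟩ := hm
  have hU : ∀ η s, stft ħ γ (fourierDist ħ hħ (toDist h)) η s =
      wave ħ (-(s * η)) * stftFun ħ (dualWindow ħ hħ γ) h (-s) η := fun η s => by
    rw [hu.toDist_eq, hu.stft_fourierDist hħ]
  refine ⟨?_, hU, W, hW, fun η s => ?_⟩
  · simp only [hU]
    refine (by fun_prop : Continuous fun z : ℝ × ℝ =>
      wave ħ (-(z.2 * z.1))).aestronglyMeasurable.mul ?_
    exact ((stronglyMeasurable_stftFun ħ hc (dualWindow ħ hħ γ)).comp_measurable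
      (by fun_prop : Measurable fun z : ℝ × ℝ => (-z.2, z.1))).aestronglyMeasurable
  · rw [hU, norm_mul, norm_wave, one_mul]
    exact hWb _ _

theorem mem_mixedL1Linf_of_le {U : ℝ × ℝ → ℂ} (hUm : AEStronglyMeasurable U) {W : ℝ → ℝ}
    (hW : Integrable W) (hUW : ∀ z, ‖U z‖ ≤ W z.1) : U ∈ mixedL1Linf := by
  refine ⟨hUm, lt_of_le_of_lt (lintegral_mono fun x => ?_) hW.2⟩
  rw [eLpNorm_exponent_top]
  refine essSup_le_of_ae_le _ (.of_forall fun ξ => ?_)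
  exact enorm_le_iff_norm_le.2 ((hUW (x, ξ)).trans (le_abs_self _))

theorem exists_innerSchwartz_ne_zero : ∃ g : 𝓢(ℝ, ℂ), innerSchwartz g g ≠ 0 := by
  obtain ⟨g, hg⟩ := exists_schwartz_apply_zero_eq_one ℝ
  have hpos := integral_norm_sq_pos (g := g) (fun h0 => by simp [h0] at hg)
  refine ⟨g, ?_⟩
  have : innerSchwartz g g = ((∫ t, ‖g t‖ ^ 2 : ℝ) : ℂ) := by
    rw [innerSchwartz, ← integral_complex_ofReal]
    refine integral_congr_ae (.of_forall fun y => ?_)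
    simp only [Complex.mul_conj, Complex.normSq_eq_norm_sq]
  rw [this]
  exact_mod_cast hpos.ne'

end FresnelSjostrand

end

/-! ### Assembly of the theorem. -/

open FresnelSjostrand
theorem proposition6p3 (ħ : ℝ) (hħ : 0 < ħ) (k : L2seq) :
    -- the functionals `T_n` and `T`, for every Gabor window `g`
    (∀ g : 𝓢(ℝ, ℂ),
      -- they are well defined linear functionals on `L¹_x(L^∞_ξ)`
      (∀ n, ∀ H ∈ mixedL1Linf, Integrable (phaseIntegrand ħ g ‖proj n k‖ H)) ∧
      (∀ H ∈ mixedL1Linf, Integrable (phaseIntegrand ħ g ‖k‖ H)) ∧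
      (∀ n, IsLinearMap ℂ
        (fun H : mixedL1Linf => phaseFunctional ħ g ‖proj n k‖ (H : ℝ × ℝ → ℂ))) ∧
      IsLinearMap ℂ (fun H : mixedL1Linf => phaseFunctional ħ g ‖k‖ (H : ℝ × ℝ → ℂ)) ∧
      -- uniform boundedness
      (∃ C : ℝ, ∀ n, ∀ H ∈ mixedL1Linf,
        ‖phaseFunctional ħ g ‖proj n k‖ H‖ ≤ C * (mixedNorm H).toReal) ∧
      -- convergence on a dense subspace
      (∃ X : Submodule ℂ (ℝ × ℝ → ℂ), X ≤ mixedL1Linf ∧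
        (∀ H ∈ mixedL1Linf, ∀ δ : ℝ≥0∞, 0 < δ → ∃ K ∈ X, mixedNorm (H - K) < δ) ∧
        ∀ H ∈ X, Tendsto (fun n => phaseFunctional ħ g ‖proj n k‖ H) atTop
          (𝓝 (phaseFunctional ħ g ‖k‖ H))) ∧
      -- convergence on the whole space
      (∀ H ∈ mixedL1Linf, Tendsto (fun n => phaseFunctional ħ g ‖proj n k‖ H) atTop
        (𝓝 (phaseFunctional ħ g ‖k‖ H)))) ∧
    (∀ h : ℝ → ℂ, MemSjostrand ħ h →
      ridge h k ∈ domainL' ħ ∧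
      (∀ g γ : 𝓢(ℝ, ℂ), innerSchwartz g γ ≠ 0 →
        (fun z : ℝ × ℝ => stft ħ γ (fourierDist ħ hħ (toDist h)) z.1 z.2) ∈ mixedL1Linf ∧
        -- the Fresnel integrals `L_n(f^{(n)})` through the functionals `T_n`
        (∀ n, HasFresnelIntegral ħ (restrictFin (ridge h k) n)
          (Complex.exp (-(Real.pi / 4 * Complex.I)) * ((innerSchwartz g γ)⁻¹ *
            phaseFunctional ħ g ‖proj n k‖
              (fun z => stft ħ γ (fourierDist ħ hħ (toDist h)) z.1 z.2)))) ∧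
        -- their limit
        functionalL' ħ (ridge h k) = Complex.exp (-(Real.pi / 4 * Complex.I)) *
          starPairing ħ g γ (fourierDist ħ hħ (toDist h))
            (fun y : ℝ => fresnelFun ħ (‖k‖ * y))) ∧
      -- functions outside the Albeverio and Høegh-Krohn class
      (k ≠ 0 → h ∉ fourierMeasures ℝ →
        (fun x : L2seq => ridge h k (x : ℕ → ℝ)) ∉ fourierMeasures L2seq)) ∧
    ∃ h : ℝ → ℂ, MemSjostrand ħ h ∧ h ∉ fourierMeasures ℝ := by
  have hproj : ∀ n, |‖proj n k‖| ≤ ‖k‖ := fun n => by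
    rw [abs_of_nonneg (norm_nonneg _)]; exact norm_proj_le n k
  have htend : ∀ g : 𝓢(ℝ, ℂ), ∀ H ∈ mixedL1Linf,
      Tendsto (fun n => phaseFunctional ħ g ‖proj n k‖ H) atTop (𝓝 (phaseFunctional ħ g ‖k‖ H)) :=
    fun g H hH => tendsto_phaseFunctional hħ g hproj (tendsto_norm_proj k) hH
  -- Convergence is already known for every `H`, so the dense subspace can be the whole space, each
  -- `H` being its own approximation.
  refine ⟨fun g => ⟨fun n H hH => integrable_phaseIntegrand hħ g _ hH,
    fun H hH => integrable_phaseIntegrand hħ g _ hH, fun n => isLinearMap_phaseFunctional hħ g _,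
    isLinearMap_phaseFunctional hħ g _, ?_, ⟨mixedL1Linf, le_rfl, fun H hH δ hδ => ⟨H, hH, ?_⟩,
    htend g⟩, htend g⟩, fun h hm => ?_, ⟨_, memSjostrand_arctan hħ, arctan_notMem_fourierMeasures⟩⟩
  · obtain ⟨C, hC⟩ := exists_norm_phaseFunctional_le hħ g ‖k‖
    exact ⟨C, fun n H hH => hC _ (hproj n) H hH⟩
  · have h0 : ∀ x : ℝ, eLpNorm (fun ξ : ℝ => (H - H) (x, ξ)) ∞ = 0 := fun x => by
      simp only [sub_self]; exact eLpNorm_zero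
    simpa only [mixedNorm, h0, lintegral_zero] using hδ
  obtain ⟨⟨B, hB⟩, -⟩ := hm.bounded_and_dominated hħ
  have hmem : ∀ γ : 𝓢(ℝ, ℂ),
      (fun z : ℝ × ℝ => stft ħ γ (fourierDist ħ hħ (toDist h)) z.1 z.2) ∈ mixedL1Linf := by
    intro γ
    obtain ⟨hUm, -, W, hW, hUW⟩ := hm.exists_majorant hħ γ
    exact mem_mixedL1Linf_of_le hUm hW fun z => hUW z.1 z.2
  have hfres : ∀ g γ : 𝓢(ℝ, ℂ), innerSchwartz g γ ≠ 0 → ∀ n,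
      HasFresnelIntegral ħ (restrictFin (ridge h k) n)
        (Complex.exp (-(Real.pi / 4 * Complex.I)) * ((innerSchwartz g γ)⁻¹ *
          phaseFunctional ħ g ‖proj n k‖
            (fun z => stft ħ γ (fourierDist ħ hħ (toDist h)) z.1 z.2))) := by
    intro g γ hgγ n
    obtain ⟨hUm, hU, W, hW, hUW⟩ := hm.exists_majorant hħ γ
    rw [restrictFin_ridge]
    exact hasFresnelIntegral_comp_inner hħ hm.1 hB hgγ hU hUm hW (fun z => hUW z.1 z.2) _
  have hconv : ∀ g γ : 𝓢(ℝ, ℂ), innerSchwartz g γ ≠ 0 →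
      Tendsto (fun n => fresnelIntegral ħ (restrictFin (ridge h k) n)) atTop
        (𝓝 (Complex.exp (-(Real.pi / 4 * Complex.I)) *
          starPairing ħ g γ (fourierDist ħ hħ (toDist h))
            (fun y : ℝ => fresnelFun ħ (‖k‖ * y)))) := by
    intro g γ hgγ
    simp only [fun n => (hfres g γ hgγ n).fresnelIntegral_eq]
    -- By definition `starPairing` with the chirp `F₊ ∘ ‖k‖` is `(innerSchwartz g γ)⁻¹` times
    -- `phaseFunctional` at `‖k‖`.
    exact ((htend g _ (hmem γ)).const_mul _).const_mul _
  refine ⟨⟨fun n => ?_, ?_⟩, fun g γ hgγ => ⟨hmem γ, hfres g γ hgγ, (hconv g γ hgγ).limUnder_eq⟩,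
    ridge_notMem_fourierMeasures⟩
  · rw [restrictFin_ridge]
    exact hm.comp_inner hħ _
  · obtain ⟨g, hg⟩ := exists_innerSchwartz_ne_zero
    exact ⟨_, hconv g g hg⟩
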